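/- Let $k$ be an algebraically closed field of characteristic different from $2$ and $3$, let $S=k[x_0,\dots,x_4]$, and let $X\subseteq\mathbb P^4_k$ be a closed subscheme with saturated homogeneous ideal $I_X\subseteq S$. Assume that $X$ is a point of $\mathcal H\mathit{ilb}_6^{aG,0}(\mathbb P^4)$, i.e. that $X$ has constant Hilbert polynomial $6$, that $X$ is arithmetically Gorenstein ($S/I_X$ is a Gorenstein ring), and that $X$ is non-degenerate (the linear subspace it generates is the whole of $\mathbb P^4$, i.e. $I_X$ contains no nonzero linear form). Say that $X$ is obtained via the Scandinavian construction if there is a $3\times3$ matrix $M=(m_{i,j})_{0\le i,j\le 2}$ whose entries are (possibly zero) linear forms in $S$, such that the ideal $F_2(M)\subseteq S$ generated by the $2\times2$ minors of $M$ has depth $4$ and $I_X=F_2(M)$. Say that $X$ is obtained via the Anglo-American construction if there is a $2\times2\times2$ cubic array $M=(m_{i,j,h})_{0\le i,j,h\le1}$ whose entries are (possibly zero) linear forms in $S$, such that the ideal $I\subseteq S$ generated by the determinants of the twelve faces of $M$ (the six ordinary faces, on which one index is constant, and the six diagonal faces, each spanned by two opposite parallel edges) has depth $4$ and $I_X=I$.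 Then $X$ can be obtained via the Anglo-American construction if and only if it can be obtained via the Scandinavian construction. -/

import Mathlib

namespace GorensteinPoints

universe u

attribute [local instance] MvPolynomial.gradedAlgebra

/-- The homogeneous coordinate ring `k[x₀, …, xₙ]` of projective `n`-space over `k`. -/
abbrev CoordRing (n : ℕ) (k : Type u) [Field k] : Type u := MvPolynomial (Fin (n + 1)) k

/-- A homogeneous ideal is saturated if it contains every polynomial `f` such that
`𝔪 ^ N * f ⊆ I` for some `N`, where `𝔪 = (x₀, …, xₙ)` is the irrelevant ideal. -/
def IsSaturated {n : ℕ} {k : Type u} [Field k] (I : Ideal (CoordRing n k)) : Prop :=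
  ∀ f : CoordRing n k,
    (∃ N : ℕ, ∀ g ∈ (Ideal.span (Set.range (MvPolynomial.X : Fin (n + 1) → CoordRing n k))) ^ N,
      g * f ∈ I) → f ∈ I

/-- A closed subscheme `X` of projective `n`-space over `k`, given by its homogeneous ideal `I_X`.
Closed subschemes of projective space correspond bijectively to saturated homogeneous ideals of
the homogeneous coordinate ring. -/
@[ext]
structure ClosedSubscheme (n : ℕ) (k : Type u) [Field k] where
  /-- The (saturated) homogeneous ideal `I_X` of the subscheme. -/
  ideal : Ideal (CoordRing n k)
  isHomogeneous : ideal.IsHomogeneous (MvPolynomial.homogeneousSubmodule (Fin (n + 1)) k)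
  isSaturated : IsSaturated ideal

/-- The Hilbert function of `k[x₀, …, xₙ] / I`: the dimension over `k` of its degree `t` part,
which is the image of the forms of degree `t`. -/
noncomputable def hilbertFunction {n : ℕ} {k : Type u} [Field k] (I : Ideal (CoordRing n k))
    (t : ℕ) : ℕ :=
  Module.finrank k
    ((MvPolynomial.homogeneousSubmodule (Fin (n + 1)) k t).map
      (Ideal.Quotient.mkₐ k I).toLinearMap)

/-- `k[x₀, …, xₙ] / I` has Hilbert polynomial `p`. -/
def HasHilbertPolynomial {n : ℕ} {k : Type u} [Field k] (I : Ideal (CoordRing n k))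
    (p : Polynomial ℚ) : Prop :=
  ∀ᶠ t : ℕ in Filter.atTop, (hilbertFunction I t : ℚ) = p.eval (t : ℚ)

/-- A Gorenstein local ring: a Noetherian local ring of finite injective dimension as a module
over itself (such a ring is automatically Cohen-Macaulay). -/
def IsGorensteinLocalRing (R : Type u) [CommRing R] : Prop :=
  IsNoetherianRing R ∧ IsLocalRing R ∧
    ∃ m : ℕ, CategoryTheory.HasInjectiveDimensionLE (ModuleCat.of R R) m

/-- A Gorenstein ring: a Noetherian ring all of whose localizations at maximal ideals are
Gorenstein local rings. -/
def IsGorensteinRing (R : Type u) [CommRing R] : Prop :=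
  IsNoetherianRing R ∧
    ∀ (P : Ideal R) [P.IsMaximal], IsGorensteinLocalRing (Localization.AtPrime P)

/-- `X` is arithmetically Gorenstein: its homogeneous coordinate ring `S_X = S / I_X` is a
Gorenstein ring. -/
def ClosedSubscheme.IsArithmeticallyGorenstein {n : ℕ} {k : Type u} [Field k]
    (X : ClosedSubscheme n k) : Prop :=
  IsGorensteinRing (CoordRing n k ⧸ X.ideal)

/-- The codimension of the linear subspace generated by `X`, i.e. the number of linearly
independent linear forms vanishing on `X`. -/
noncomputable def ClosedSubscheme.spanCodim {n : ℕ} {k : Type u} [Field k]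
    (X : ClosedSubscheme n k) : ℕ :=
  Module.finrank k
    ((X.ideal.restrictScalars k) ⊓ MvPolynomial.homogeneousSubmodule (Fin (n + 1)) k 1 :
      Submodule k (CoordRing n k))

/-- The (closed) points of the locus of the Hilbert scheme of projective `n`-space given by the
arithmetically Gorenstein closed subschemes with constant Hilbert polynomial `d` that generate a
linear subspace of codimension `r`. -/
def hilbAG (n : ℕ) (k : Type u) [Field k] (d r : ℕ) : Set (ClosedSubscheme n k) :=
  {X | HasHilbertPolynomial X.ideal (Polynomial.C (d : ℚ)) ∧
    X.IsArithmeticallyGorenstein ∧ X.spanCodim = r}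

/-- The depth (grade) of an ideal: the supremum of the lengths of the regular sequences
contained in it. -/
noncomputable def idealDepth {R : Type u} [CommRing R] (I : Ideal R) : ℕ∞ :=
  ⨆ rs ∈ {rs : List R | (∀ r ∈ rs, r ∈ I) ∧ RingTheory.Sequence.IsRegular R rs},
    (rs.length : ℕ∞)

/-- The ideal generated by the `t × t` minors of a matrix. -/
def minorsIdeal {R : Type u} [CommRing R] {a b : ℕ} (t : ℕ) (M : Matrix (Fin a) (Fin b) R) :
    Ideal R :=
  Ideal.span {f | ∃ (r : Fin t ↪o Fin a) (c : Fin t ↪o Fin b), f = (M.submatrix r c).det}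

/-- The ideal generated by the determinants of the twelve faces of a `2 × 2 × 2` cubic array:
first the six ordinary faces, on which one index is constant, then the six diagonal faces, each
spanned by two opposite parallel edges. -/
def facesIdeal {R : Type u} [CommRing R] (m : Fin 2 → Fin 2 → Fin 2 → R) : Ideal R :=
  Ideal.span
    {f | ∃ a : Fin 2,
      f = !![m a 0 0, m a 0 1; m a 1 0, m a 1 1].det ∨
      f = !![m 0 a 0, m 0 a 1; m 1 a 0, m 1 a 1].det ∨
      f = !![m 0 0 a, m 0 1 a; m 1 0 a, m 1 1 a].det ∨
      f = !![m 0 0 a, m 0 1 a.rev; m 1 0 a, m 1 1 a.rev].det ∨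
      f = !![m a 0 0, m a.rev 0 1; m a 1 0, m a.rev 1 1].det ∨
      f = !![m a 0 0, m a.rev 1 0; m a 0 1, m a.rev 1 1].det}

/-- `X ⊆ ℙ⁴` is obtained via the Scandinavian construction: its homogeneous ideal is the ideal of
`2 × 2` minors, of depth `4`, of some `3 × 3` matrix of linear forms. -/
def IsScandinavian {k : Type u} [Field k] (X : ClosedSubscheme 4 k) : Prop :=
  ∃ M : Matrix (Fin 3) (Fin 3) (CoordRing 4 k),
    (∀ i j, (M i j).IsHomogeneous 1) ∧
    idealDepth (minorsIdeal 2 M) = 4 ∧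
    X.ideal = minorsIdeal 2 M

/-- `X ⊆ ℙ⁴` is obtained via the Anglo-American construction: its homogeneous ideal is the ideal,
of depth `4`, generated by the face determinants of some `2 × 2 × 2` cubic array of linear
forms. -/
def IsAngloAmerican {k : Type u} [Field k] (X : ClosedSubscheme 4 k) : Prop :=
  ∃ m : Fin 2 → Fin 2 → Fin 2 → CoordRing 4 k,
    (∀ i j h, (m i j h).IsHomogeneous 1) ∧
    idealDepth (facesIdeal m) = 4 ∧
    X.ideal = facesIdeal m

end GorensteinPoints

/-! If the opposite corners 000 and 111 of a cubic array carry the same entry, its faces impose the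
same relations as the minors of the `3 × 3` matrix with that entry along the diagonal and the six
other entries off it (`facesIdeal_eq_minorsIdeal`). Invertible row and column operations, and base
changes in the three factors `k²`, preserve the ideals. So it suffices to bring a matrix to constant
diagonal and an array to equal corners.

Depth 4 in five variables leaves only finitely many lines through the origin in the zero locus
(`exists_finset_lines`). The values of the linear forms make up a linear space `R` of matrices or
arrays, whose elements of rank at most one therefore lie on finitely many lines. Both normal forms
are found in the annihilator of `R`.

Matrices (`exists_equal_diagonal`): if all of `R^⊥` were singular, adjugates of its members would be
orthogonal to `R^⊥`, hence would be elements of `R` of rank at most one. Finiteness then gives `R^⊥`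
a common left or right kernel vector, which puts infinitely many rank one lines in `R`. So an
invertible member exists, and may be taken to be the identity. The same argument, after subtracting
a repeated eigenvalue, yields a member with distinct eigenvalues. In its eigenbasis, two diagonal
conditions fix the diagonal of `R` up to scale, and rescaling rows makes it constant.

Arrays (`exists_equal_corners`): a trilinear form in `R^⊥` with nonzero hyperdeterminant is a
difference of two decomposable forms with independent factors, which says that two opposite corners
agree on `R`. If every hyperdeterminant vanished, `R` would contain infinitely many lines of
decomposable arrays. -/

/-! ### Depth, height and the lines in a zero locus -/

/-- Restriction of polynomials to the line spanned by `x`, with coordinate `X`. -/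
noncomputable def lineRestriction {n : ℕ} {k : Type*} [Field k] (x : Fin (n + 1) → k) :
    MvPolynomial (Fin (n + 1)) k →ₐ[k] Polynomial k :=
  MvPolynomial.aeval (fun i => Polynomial.C (x i) * Polynomial.X)

/-- The last element is a nonzerodivisor modulo the earlier ones, so it avoids every minimal prime
over them. Each element thus raises the height by at least one. -/
theorem RingTheory.Sequence.IsWeaklyRegular.length_le_height {R : Type*} [CommRing R]
    [IsNoetherianRing R] (rs : List R) (h : RingTheory.Sequence.IsWeaklyRegular R rs)
    (P : Ideal R) [P.IsPrime] (hP : ∀ r ∈ rs, r ∈ P) : (rs.length : ℕ∞) ≤ P.height := by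
  induction rs using List.reverseRecOn generalizing P with
  | nil => simp
  | append_singleton rs r ih =>
    rw [RingTheory.Sequence.isWeaklyRegular_append_iff,
      RingTheory.Sequence.isWeaklyRegular_singleton_iff] at h
    obtain ⟨h₁, h₂⟩ := h
    have hle : Ideal.ofList rs ≤ P := by
      rw [Ideal.ofList, Ideal.span_le]
      intro a ha
      exact hP a (List.mem_append_left _ ha)
    obtain ⟨Q, hQ, hQP⟩ := Ideal.exists_minimalPrimes_le hle
    have hQprime := hQ.isPrime
    have hann : Module.annihilator R (R ⧸ (Ideal.ofList rs • ⊤ : Submodule R R))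
        = Ideal.ofList rs := by
      simp [Ideal.annihilator_quotient]
    have hr : r ∉ Q := by
      apply h₂.notMem_of_mem_minimalPrimes
      rw [hann]
      exact hQ
    have hlt : Q < P := lt_of_le_of_ne hQP (fun e => hr (e ▸ hP r (by simp)))
    have h₃ := ih h₁ Q (fun a ha => hQ.1.2 (Ideal.subset_span ha))
    have h₄ := Ideal.height_strict_mono_of_isPrime_of_isPrime hlt
    rw [List.length_append, List.length_singleton, Nat.cast_add, Nat.cast_one]
    exact (add_le_add_left h₃ 1).trans (Order.add_one_le_of_lt h₄)

theorem idealDepth_le_height {R : Type*} [CommRing R] [IsNoetherianRing R] {I P : Ideal R}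
    [P.IsPrime] (h : I ≤ P) : GorensteinPoints.idealDepth I ≤ P.height := by
  refine iSup₂_le fun rs hrs => ?_
  exact hrs.2.toIsWeaklyRegular.length_le_height rs P (fun r hr => h (hrs.1 r hr))

section
variable {n : ℕ} {k : Type*} [Field k]

@[simp]
theorem lineRestriction_X (x : Fin (n + 1) → k) (i : Fin (n + 1)) :
    lineRestriction x (MvPolynomial.X i) = Polynomial.C (x i) * Polynomial.X := by
  simp [lineRestriction]

/-- The ideal of the line lies strictly inside the maximal ideal of the origin, because some
coordinate is nonzero on the line. -/
theorem height_ker_lineRestriction_le {x : Fin (n + 1) → k} (hx : x ≠ 0) :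
    (RingHom.ker (lineRestriction x)).height ≤ n := by
  let ε : MvPolynomial (Fin (n + 1)) k →ₐ[k] k := MvPolynomial.aeval 0
  have hprime : (RingHom.ker ε).IsPrime := RingHom.ker_isPrime _
  have hle : (RingHom.ker ε).height ≤ (n + 1 : ℕ) := by
    have h₁ := Ideal.height_le_ringKrullDim_of_ne_top hprime.ne_top
    rw [MvPolynomial.ringKrullDim_of_isNoetherianRing, ringKrullDim_eq_zero_of_field, zero_add,
      Nat.card_fin] at h₁
    exact_mod_cast h₁
  have hp : (RingHom.ker (lineRestriction x)).IsPrime := RingHom.ker_isPrime _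
  have hεl : ∀ f, ε f = (lineRestriction x f).eval 0 := by
    intro f
    have : ε = (Polynomial.aeval (0 : k)).comp (lineRestriction x) := by
      ext i
      simp [ε]
    rw [this]
    simp
  have hlt : RingHom.ker (lineRestriction x) < RingHom.ker ε := by
    refine lt_of_le_of_ne ?_ ?_
    · intro f hf
      rw [RingHom.mem_ker] at hf ⊢
      rw [hεl, hf]
      simp
    · intro e
      apply hx
      funext i
      have : (MvPolynomial.X i : MvPolynomial (Fin (n + 1)) k) ∈ RingHom.ker ε := by
        simp [RingHom.mem_ker, ε]
      rw [← e, RingHom.mem_ker] at this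
      simpa using this
  have h₁ := Ideal.height_strict_mono_of_isPrime_of_isPrime hlt
  have h₂ := h₁.trans_le hle
  rw [Nat.cast_add, Nat.cast_one] at h₂
  exact Order.le_of_lt_add_one h₂

/-- If an ideal in `n + 1` variables has depth at least `n`, then the lines on which it vanishes are
finite in number. -/
theorem exists_finset_lines {I : Ideal (MvPolynomial (Fin (n + 1)) k)}
    (hI : (n : ℕ∞) ≤ GorensteinPoints.idealDepth I) :
    ∃ F : Finset (Fin (n + 1) → k), ∀ x, I ≤ RingHom.ker (lineRestriction x) →
      ∃ p ∈ F, ∃ c : k, x = c • p := by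
  classical
  let L : (Fin (n + 1) → k) → Ideal (MvPolynomial (Fin (n + 1)) k) :=
    fun x => RingHom.ker (lineRestriction x)
  let T : Set (Ideal (MvPolynomial (Fin (n + 1)) k)) := {P ∈ I.minimalPrimes | ∃ x, x ≠ 0 ∧ L x = P}
  have hT : T.Finite := (Ideal.finite_minimalPrimes_of_isNoetherianRing _ I).subset (fun P h => h.1)
  have hch : ∀ P : Ideal (MvPolynomial (Fin (n + 1)) k), ∃ x, P ∈ T → x ≠ 0 ∧ L x = P := by
    intro P
    by_cases h : P ∈ T
    · obtain ⟨x, hx⟩ := h.2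
      exact ⟨x, fun _ => hx⟩
    · exact ⟨0, fun h' => absurd h' h⟩
  choose r hr using hch
  refine ⟨insert 0 (hT.toFinset.image r), fun x hxI => ?_⟩
  by_cases hx : x = 0
  · exact ⟨0, by simp, 0, by simp [hx]⟩
  have hp : (L x).IsPrime := RingHom.ker_isPrime _
  -- Primes containing `I` have height at least `n` and the ideal of a line has height at most `n`,
  -- so nothing fits strictly between `I` and a line.
  have hmin : L x ∈ I.minimalPrimes := by
    obtain ⟨Q, hQ, hQx⟩ := Ideal.exists_minimalPrimes_le (J := L x) hxI
    have := hQ.isPrime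
    have h₁ : (n : ℕ∞) ≤ Q.height := hI.trans (idealDepth_le_height hQ.1.2)
    rcases hQx.lt_or_eq with h | h
    · have h₂ := Ideal.height_strict_mono_of_isPrime_of_isPrime h
      exact absurd (h₁.trans_lt (h₂.trans_le (height_ker_lineRestriction_le hx))) (lt_irrefl _)
    · exact h ▸ hQ
  have hxT : L x ∈ T := ⟨hmin, x, hx, rfl⟩
  obtain ⟨hp0, hpx⟩ := hr _ hxT
  refine ⟨r (L x), Finset.mem_insert_of_mem (Finset.mem_image_of_mem _ (hT.mem_toFinset.2 hxT)), ?_⟩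
  set p := r (L x)
  obtain ⟨j, hj⟩ := Function.ne_iff.1 hp0
  rw [Pi.zero_apply] at hj
  refine ⟨x j / p j, funext fun i => ?_⟩
  -- These linear equations of the line through `p` recover it from its ideal.
  have h₁ : MvPolynomial.C (p j) * MvPolynomial.X i - MvPolynomial.C (p i) * MvPolynomial.X j
      ∈ L p := by
    rw [RingHom.mem_ker]
    simp [map_sub, map_mul, MvPolynomial.algHom_C]
    ring
  rw [hpx, RingHom.mem_ker] at h₁
  simp only [map_sub, map_mul, MvPolynomial.algHom_C, lineRestriction_X,
    Polynomial.algebraMap_eq] at h₁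
  have h₂ := congrArg (Polynomial.eval 1) h₁
  simp at h₂
  rw [Pi.smul_apply, smul_eq_mul]
  field_simp
  linear_combination h₂

theorem exists_linear_of_isHomogeneous_one {f : MvPolynomial (Fin (n + 1)) k}
    (hf : f.IsHomogeneous 1) :
    ∃ φ : (Fin (n + 1) → k) →ₗ[k] k, ∀ x, MvPolynomial.eval x f = φ x ∧
      lineRestriction x f = Polynomial.C (φ x) * Polynomial.X := by
  have hf' : f ∈ MvPolynomial.homogeneousSubmodule (Fin (n + 1)) k 1 := hf
  rw [MvPolynomial.homogeneousSubmodule_one_eq_span_X] at hf'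
  clear hf
  induction hf' using Submodule.span_induction with
  | mem f h =>
    obtain ⟨i, rfl⟩ := h
    exact ⟨LinearMap.proj i, fun x => by simp⟩
  | zero => exact ⟨0, fun x => by simp⟩
  | add f g hf hg h₁ h₂ =>
    obtain ⟨φ, hφ⟩ := h₁
    obtain ⟨ψ, hψ⟩ := h₂
    refine ⟨φ + ψ, fun x => ?_⟩
    simp [(hφ x).1, (hφ x).2, (hψ x).1, (hψ x).2, add_mul]
  | smul a f hf h₁ =>
    obtain ⟨φ, hφ⟩ := h₁
    refine ⟨a • φ, fun x => ?_⟩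
    simp [(hφ x).1, (hφ x).2, Polynomial.smul_eq_C_mul, mul_assoc]
end

/-! ### Polynomial functions and finite unions of lines -/

/-- A function on a vector space whose restriction to every affine line is a polynomial. -/
def PolynomialOnLines (k : Type*) {V : Type*} [Field k] [AddCommGroup V] [Module k V]
    (f : V → k) : Prop :=
  ∀ x z : V, ∃ F : Polynomial k, ∀ t : k, F.eval t = f (x + t • z)

section
variable {k V : Type*} [Field k] [AddCommGroup V] [Module k V]

namespace PolynomialOnLines

theorem const (c : k) : PolynomialOnLines k (fun _ : V => c) :=
  fun _ _ => ⟨Polynomial.C c, fun t => by simp⟩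

theorem linear (φ : V →ₗ[k] k) : PolynomialOnLines k (fun x => φ x) :=
  fun x z => ⟨Polynomial.C (φ x) + Polynomial.X * Polynomial.C (φ z), fun t => by simp; ring⟩

theorem add {f g : V → k} (hf : PolynomialOnLines k f) (hg : PolynomialOnLines k g) :
    PolynomialOnLines k (fun x => f x + g x) := fun x z => by
  obtain ⟨F, hF⟩ := hf x z
  obtain ⟨G, hG⟩ := hg x z
  exact ⟨F + G, fun t => by simp [hF, hG]⟩

theorem mul {f g : V → k} (hf : PolynomialOnLines k f) (hg : PolynomialOnLines k g) :
    PolynomialOnLines k (fun x => f x * g x) := fun x z => by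
  obtain ⟨F, hF⟩ := hf x z
  obtain ⟨G, hG⟩ := hg x z
  exact ⟨F * G, fun t => by simp [hF, hG]⟩

theorem sub {f g : V → k} (hf : PolynomialOnLines k f) (hg : PolynomialOnLines k g) :
    PolynomialOnLines k (fun x => f x - g x) := fun x z => by
  obtain ⟨F, hF⟩ := hf x z
  obtain ⟨G, hG⟩ := hg x z
  exact ⟨F - G, fun t => by simp [hF, hG]⟩

theorem pow {f : V → k} (hf : PolynomialOnLines k f) (n : ℕ) :
    PolynomialOnLines k (fun x => f x ^ n) := fun x z => by
  obtain ⟨F, hF⟩ := hf x z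
  exact ⟨F ^ n, fun t => by simp [hF]⟩

theorem bilinear (A : V →ₗ[k] V →ₗ[k] k) : PolynomialOnLines k (fun x => A x x) := fun x z =>
  ⟨Polynomial.C (A x x) + Polynomial.X * Polynomial.C (A x z + A z x)
    + Polynomial.X ^ 2 * Polynomial.C (A z z), fun t => by simp; ring⟩

/-- Restrict to the line joining a point where `f` is nonzero to one where `g` is nonzero; `k[t]` is
a domain. -/
theorem eq_zero_or_eq_zero [Infinite k] {f g : V → k} (hf : PolynomialOnLines k f)
    (hg : PolynomialOnLines k g) (h : ∀ x, f x * g x = 0) : (∀ x, f x = 0) ∨ ∀ x, g x = 0 := by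
  by_contra! hcon
  obtain ⟨⟨x, hx⟩, ⟨y, hy⟩⟩ := hcon
  obtain ⟨F, hF⟩ := hf x (y - x)
  obtain ⟨G, hG⟩ := hg x (y - x)
  have hFG : F * G = 0 := Polynomial.funext fun t => by
    rw [Polynomial.eval_mul, hF, hG, h, Polynomial.eval_zero]
  rcases mul_eq_zero.1 hFG with h0 | h0
  · apply hx
    simpa [h0] using (hF 0).symm
  · apply hy
    simpa [h0] using (hG 1).symm

theorem exists_forall_eq_zero [Infinite k] {ι : Type*} (F : Finset ι) (f : ι → V → k)
    (hf : ∀ i, PolynomialOnLines k (f i)) (h : ∀ x, ∃ i ∈ F, f i x = 0) :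
    ∃ i ∈ F, ∀ x, f i x = 0 := by
  classical
  have aux : ∀ F : Finset ι, PolynomialOnLines k (fun x => ∏ i ∈ F, f i x) ∧
      ((∀ x, ∏ i ∈ F, f i x = 0) → ∃ i ∈ F, ∀ x, f i x = 0) := by
    intro F
    induction F using Finset.induction_on with
    | empty => exact ⟨by simpa using const (V := V) (1 : k), fun h => by simpa using h 0⟩
    | insert i F hi ih =>
      simp only [Finset.prod_insert hi]
      refine ⟨(hf i).mul ih.1, fun h => ?_⟩
      rcases (hf i).eq_zero_or_eq_zero ih.1 h with h' | h'
      · exact ⟨i, Finset.mem_insert_self _ _, h'⟩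
      · obtain ⟨j, hj, hj'⟩ := ih.2 h'
        exact ⟨j, Finset.mem_insert_of_mem hj, hj'⟩
  refine (aux F).2 fun x => ?_
  obtain ⟨i, hi, hx⟩ := h x
  exact Finset.prod_eq_zero hi hx

/-- A polynomial map from a vector space to a finite union of lines has image in one line. -/
theorem exists_line [Infinite k] {ι : Type*} (F : Finset (ι → k)) (g : V → ι → k)
    (hg : ∀ i, PolynomialOnLines k (fun x => g x i)) (h : ∀ x, ∃ N ∈ F, ∃ c : k, g x = c • N) :
    ∃ N, ∀ x, ∃ c : k, g x = c • N := by
  by_contra! hcon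
  -- For each line, take a coordinate or a `2 × 2` minor that vanishes whenever `g x` is on the
  -- line, but not identically. The hypothesis makes the product over `F` vanish everywhere.
  have key : ∀ N : ι → k, ∃ f : V → k, PolynomialOnLines k f ∧ (∃ x, f x ≠ 0) ∧
      ∀ x, (∃ c : k, g x = c • N) → f x = 0 := by
    intro N
    obtain ⟨x, hx⟩ := hcon N
    by_cases hN : N = 0
    · subst hN
      obtain ⟨i, hi⟩ := Function.ne_iff.1 (hx 0)
      exact ⟨fun y => g y i, hg i, ⟨x, by simpa using hi⟩, fun y ⟨c, hc⟩ => by simp [hc]⟩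
    · obtain ⟨j, hj⟩ := Function.ne_iff.1 hN
      rw [Pi.zero_apply] at hj
      obtain ⟨i, hi⟩ := Function.ne_iff.1 (hx (g x j / N j))
      refine ⟨fun y => N j * g y i - N i * g y j,
        ((const _).mul (hg i)).sub ((const _).mul (hg j)), ⟨x, fun h0 => hi ?_⟩, ?_⟩
      · rw [Pi.smul_apply, smul_eq_mul]
        field_simp
        linear_combination h0
      · rintro y ⟨c, hc⟩
        simp only [hc, Pi.smul_apply, smul_eq_mul]
        ring
  choose f hf hne hz using key
  obtain ⟨N, -, hN⟩ := exists_forall_eq_zero F f hf (fun x => by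
    obtain ⟨N, hN, hc⟩ := h x
    exact ⟨N, hN, hz N x hc⟩)
  obtain ⟨x, hx⟩ := hne N
  exact hx (hN x)

end PolynomialOnLines

/-- Pigeonhole principle. Every later contradiction with finiteness comes from applying this to a
family of pairwise non-proportional rank one elements. -/
theorem exists_ne_smul_eq_of_mem_lines [Infinite k] (F : Finset V) (w : k → V)
    (hw : ∀ t, w t ≠ 0) (h : ∀ t, ∃ N ∈ F, ∃ c : k, w t = c • N) :
    ∃ t t', t ≠ t' ∧ ∃ c : k, w t' = c • w t := by
  choose N hN c hc using h
  obtain ⟨t, t', hne, heq⟩ := Finite.exists_ne_map_eq_of_infinite (fun t => (⟨N t, hN t⟩ : F))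
  have heq' : N t = N t' := congrArg Subtype.val heq
  have hct : c t ≠ 0 := fun h0 => hw t (by rw [hc t, h0, zero_smul])
  refine ⟨t, t', hne, c t' / c t, ?_⟩
  rw [hc t', hc t, smul_smul, heq', div_mul_cancel₀ _ hct]

/-! ### Quadratic forms and spaces of rank one matrices -/

/-- A quadratic form over an algebraically closed field is either the square of a linear form or
admits a hyperbolic pair. -/
theorem exists_eq_sq_or_hyperbolic [IsAlgClosed k] (h2 : (2 : k) ≠ 0) (A : V →ₗ[k] V →ₗ[k] k)
    (hA : ∀ x y, A x y = A y x) :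
    (∃ l : V →ₗ[k] k, ∀ x, A x x = l x ^ 2) ∨ ∃ x y, A x x = 0 ∧ A y y = 0 ∧ A x y = 1 := by
  by_cases hz : ∀ x, A x x = 0
  · exact Or.inl ⟨0, fun x => by simp [hz]⟩
  push Not at hz
  obtain ⟨T, hT⟩ := hz
  obtain ⟨r, hr⟩ := IsAlgClosed.exists_pow_nat_eq (A T T) (n := 2) (by norm_num)
  have hr0 : r ≠ 0 := by rintro rfl; exact hT (by rw [← hr]; ring)
  -- Equality says that the plane spanned by `x` and `T` is degenerate. If this holds for all `x`,
  -- the form is a multiple of the square of `A T`.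
  by_cases hl : ∀ x, A x x * A T T = A x T ^ 2
  · refine Or.inl ⟨r⁻¹ • A T, fun x => ?_⟩
    have := hl x
    rw [LinearMap.smul_apply, smul_eq_mul, hA T x, mul_pow, ← this, ← hr]
    field_simp
  push Not at hl
  obtain ⟨x, hx⟩ := hl
  obtain ⟨d, hd⟩ := IsAlgClosed.exists_pow_nat_eq (A x T ^ 2 - A x x * A T T) (n := 2) (by norm_num)
  have hd0 : d ≠ 0 := by
    rintro rfl
    apply hx
    linear_combination hd
  have e := hA T x
  -- The isotropic vectors of the plane come from the quadratic formula, with `d` a root of the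
  -- discriminant. Their pairing is `-2 * A T T * d ^ 2`, whence the scalar.
  refine Or.inr ⟨(A T T) • x + (-A x T + d) • T,
    (-(2 * A T T * d ^ 2)⁻¹) • ((A T T) • x + (-A x T - d) • T), ?_, ?_, ?_⟩
  · simp only [map_add, map_smul, LinearMap.add_apply, LinearMap.smul_apply, smul_eq_mul, e]
    linear_combination A T T * hd
  · simp only [map_add, map_smul, LinearMap.add_apply, LinearMap.smul_apply, smul_eq_mul, e]
    linear_combination A T T * ((2 * A T T * d ^ 2)⁻¹) ^ 2 * hd
  · simp only [map_add, map_smul, LinearMap.add_apply, LinearMap.smul_apply, smul_eq_mul, e]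
    field_simp
    linear_combination (-1 : k) * hd

/-- A quadratic form vanishing on the zero locus of a form with a hyperbolic pair is proportional
to it. -/
theorem exists_proportional_of_hyperbolic (h2 : (2 : k) ≠ 0) (h3 : (3 : k) ≠ 0)
    (A B : V →ₗ[k] V →ₗ[k] k)
    (hA : ∀ x y, A x y = A y x) (hB : ∀ x y, B x y = B y x) {p q : V} (hp : A p p = 0)
    (hq : A q q = 0) (hpq : A p q = 1) (h : ∀ x, A x x = 0 → B x x = 0) :
    ∃ β : k, ∀ x, B x x = β * A x x := by
  refine ⟨B p q, fun w => ?_⟩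
  have hBp := h p hp
  have hBq := h q hq
  obtain ⟨v, hv⟩ : ∃ v, v = w - A w q • p - A w p • q := ⟨_, rfl⟩
  have hvp : A v p = 0 := by
    rw [hv]
    simp [hp, hA q p, hpq]
  have hvq : A v q = 0 := by
    rw [hv]
    simp [hq, hpq]
  have hpv := hA p v
  have hqv := hA q v
  have hqp := hA q p
  have hpv' := hB p v
  have hqv' := hB q v
  have hqp' := hB q p
  -- With `v` orthogonal to `p` and `q`, the points `v + x • p + y • q` with `2 * x * y = - A v v`
  -- are isotropic, so `B` vanishes there.
  have key : ∀ x y : k, 2 * x * y = - A v v →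
      B v v + 2 * x * B v p + 2 * y * B v q - A v v * B p q = 0 := by
    intro x y hxy
    have h₁ : A (v + x • p + y • q) (v + x • p + y • q) = 0 := by
      simp only [map_add, map_smul, LinearMap.add_apply, LinearMap.smul_apply, smul_eq_mul, hpv,
        hqv, hqp, hvp, hvq, hp, hq, hpq]
      linear_combination hxy
    have h₂ := h _ h₁
    simp only [map_add, map_smul, LinearMap.add_apply, LinearMap.smul_apply, smul_eq_mul, hpv',
      hqv', hqp', hBp, hBq] at h₂
    linear_combination h₂ - B p q * hxy
  have h4 : (4 : k) ≠ 0 := by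
    rw [show (4 : k) = 2 * 2 by norm_num]
    exact mul_ne_zero h2 h2
  -- Dividing by 4 gives enough explicit solutions to isolate `B v v`, `B v p` and `B v q`.
  obtain ⟨e, he⟩ : ∃ e, A v v = 4 * e := ⟨A v v / 4, by field_simp⟩
  have k1 := key 1 (-2 * e) (by rw [he]; ring)
  have k2 := key (-1) (2 * e) (by rw [he]; ring)
  have k3 := key 2 (-e) (by rw [he]; ring)
  have k4 := key (-2 * e) 1 (by rw [he]; ring)
  have k6 := key (-e) 2 (by rw [he]; ring)
  have hvv : B v v = A v v * B p q := by
    have : 2 * (B v v - A v v * B p q) = 0 := by linear_combination k1 + k2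
    simpa [h2, sub_eq_zero] using this
  have hBvp : B v p = 0 := by
    have : 2 * 3 * B v p = 0 := by linear_combination 2 * k3 - k1 - hvv
    simpa [h2, h3] using this
  have hBvq : B v q = 0 := by
    have : 2 * 3 * B v q = 0 := by linear_combination 2 * k6 - k4 - hvv
    simpa [h2, h3] using this
  have hw : w = v + A w q • p + A w p • q := by rw [hv]; abel
  have e₁ : A w w = A v v + 2 * A w q * A w p := by
    conv_lhs => rw [hw]
    simp only [map_add, map_smul, LinearMap.add_apply, LinearMap.smul_apply, smul_eq_mul, hpv,
        hqv, hqp, hvp, hvq, hp, hq, hpq]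
    ring
  have e₂ : B w w = B v v + 2 * A w q * A w p * B p q := by
    conv_lhs => rw [hw]
    simp only [map_add, map_smul, LinearMap.add_apply, LinearMap.smul_apply, smul_eq_mul, hpv',
        hqv', hqp', hBp, hBq, hBvp, hBvq]
    ring
  rw [e₁, e₂, hvv]
  ring

/-- A linear space of matrices of rank at most one has a common left or right kernel vector. -/
theorem exists_common_kernel {ι κ : Type*} [Fintype ι] [Fintype κ] [Nontrivial ι] [Nontrivial κ]
    [Infinite k] (φ : V →ₗ[k] Matrix ι κ k)
    (h : ∀ x i i' j j', φ x i j * φ x i' j' = φ x i j' * φ x i' j) :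
    (∃ u : ι → k, u ≠ 0 ∧ ∀ x j, ∑ i, u i * φ x i j = 0) ∨
      ∃ v : κ → k, v ≠ 0 ∧ ∀ x i, ∑ j, φ x i j * v j = 0 := by
  classical
  by_cases hz : ∀ x i j, φ x i j = 0
  · exact Or.inl ⟨fun _ => 1, fun h => one_ne_zero (congrFun h (Classical.arbitrary ι)),
      fun x j => by simp [hz]⟩
  push Not at hz
  obtain ⟨a, i, j, ha⟩ := hz
  have entry : ∀ i j, PolynomialOnLines k (fun x => φ x i j) := fun i j =>
    PolynomialOnLines.linear ((LinearMap.proj j).comp ((LinearMap.proj i).comp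
      φ : V →ₗ[k] κ → k))
  have polar : ∀ x i i' j j', φ a i j * φ x i' j' + φ x i j * φ a i' j'
      = φ a i j' * φ x i' j + φ x i j' * φ a i' j := by
    intro x i i' j j'
    have h₁ := h (a + x) i i' j j'
    simp only [map_add, Matrix.add_apply] at h₁
    linear_combination h₁ - h a i i' j j' - h x i i' j j'
  -- Either column `j` is always proportional to column `j` of `φ a`, or row `i` is always
  -- proportional to row `i` of `φ a`: the product of the two defects vanishes identically.
  by_cases hρ : ∀ i' x, φ a i j * φ x i' j - φ a i' j * φ x i j = 0
  · left
    obtain ⟨m, hm⟩ := exists_ne i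
    refine ⟨φ a i j • Pi.single m 1 - φ a m j • Pi.single i 1, fun h0 => ha ?_, fun x l => ?_⟩
    · have := congrFun h0 m
      simpa [Pi.single_apply, hm] using this
    · simp only [Pi.sub_apply, Pi.smul_apply, smul_eq_mul, sub_mul, Finset.sum_sub_distrib, mul_assoc,
        ← Finset.mul_sum, Pi.single_apply, ite_mul, one_mul, zero_mul, Finset.sum_ite_eq',
        Finset.mem_univ, if_true]
      apply mul_left_cancel₀ ha
      linear_combination φ a i j * polar x i m j l + φ a i l * hρ m x - φ x i j * h a i m j l
  · right
    push Not at hρ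
    obtain ⟨i', x₀, hx₀⟩ := hρ
    have hγ : ∀ j' x, φ a i j * φ x i j' - φ a i j' * φ x i j = 0 := by
      intro j'
      refine (PolynomialOnLines.eq_zero_or_eq_zero (f := fun x => φ a i j * φ x i' j - φ a i' j * φ x i j)
        (((PolynomialOnLines.const _).mul (entry i' j)).sub
          ((PolynomialOnLines.const _).mul (entry i j)))
        (((PolynomialOnLines.const _).mul (entry i j')).sub
          ((PolynomialOnLines.const _).mul (entry i j))) fun x => ?_).resolve_left
        (fun h0 => hx₀ (h0 x₀))
      linear_combination (φ a i j)^2 * (- h x i i' j j') + φ a i j * φ x i j * polar x i i' j j'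
         - φ x i j ^ 2 * h a i i' j j'
    obtain ⟨m, hm⟩ := exists_ne j
    refine ⟨φ a i j • Pi.single m 1 - φ a i m • Pi.single j 1, fun h0 => ha ?_, fun x l => ?_⟩
    · have := congrFun h0 m
      simpa [Pi.single_apply, hm] using this
    · simp only [Pi.sub_apply, Pi.smul_apply, smul_eq_mul, mul_sub, Finset.sum_sub_distrib,
        Pi.single_apply, mul_ite, mul_one, mul_zero, Finset.sum_ite_eq',
        Finset.mem_univ, if_true]
      apply mul_left_cancel₀ ha
      linear_combination φ a i j * polar x i l j m + φ a l j * hγ m x - φ x i j * h a i l j m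
end

/-! ### Cubic arrays and the hyperdeterminant -/

/-- The symmetrised product of two linear forms, as a bilinear form. -/
noncomputable def symMul {k V : Type*} [Field k] [AddCommGroup V] [Module k V]
    (a b : V →ₗ[k] k) : V →ₗ[k] V →ₗ[k] k :=
  LinearMap.mk₂ k (fun x y => (a x * b y + a y * b x) / 2)
    (fun x x' y => by simp only [map_add]; ring) (fun c x y => by simp only [map_smul, smul_eq_mul]; ring)
    (fun x y y' => by simp only [map_add]; ring) (fun c x y => by simp only [map_smul, smul_eq_mul]; ring)

section
variable {k V : Type*} [Field k] [AddCommGroup V] [Module k V]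

theorem symMul_apply (a b : V →ₗ[k] k) (x y : V) :
    symMul a b x y = (a x * b y + a y * b x) / 2 := rfl

theorem symMul_comm (a b : V →ₗ[k] k) (x y : V) : symMul a b x y = symMul a b y x := by
  rw [symMul_apply, symMul_apply, add_comm]

theorem symMul_self (h2 : (2 : k) ≠ 0) (a b : V →ₗ[k] k) (x : V) :
    symMul a b x x = a x * b x := by
  rw [symMul_apply]
  field_simp
  ring
end

section
variable {k : Type*} [Field k]

/-- The decomposable cubic array `s ⊗ y ⊗ z`. -/
def pureArray (s y z : Fin 2 → k) : Fin 2 → Fin 2 → Fin 2 → k := fun i j h => s i * y j * z h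

theorem pureArray_ne_zero {s y z : Fin 2 → k} (hs : s ≠ 0) (hy : y ≠ 0) (hz : z ≠ 0) :
    pureArray s y z ≠ 0 := by
  obtain ⟨i, hi⟩ := Function.ne_iff.1 hs
  obtain ⟨j, hj⟩ := Function.ne_iff.1 hy
  obtain ⟨h, hh⟩ := Function.ne_iff.1 hz
  intro h0
  have := congrFun (congrFun (congrFun h0 i) j) h
  simp only [pureArray, Pi.zero_apply, mul_eq_zero] at this
  tauto

/-- The slice of the trilinear form `T` at the vector `s` of the first factor. -/
def slice (T : Module.Dual k (Fin 2 → Fin 2 → Fin 2 → k)) (s : Fin 2 → k) :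
    Matrix (Fin 2) (Fin 2) k :=
  fun i j => T (pureArray s (Pi.single i 1) (Pi.single j 1))

theorem apply_eq_sum (T : Module.Dual k (Fin 2 → Fin 2 → Fin 2 → k))
    (r : Fin 2 → Fin 2 → Fin 2 → k) :
    T r = ∑ a, ∑ i, ∑ j, r a i j * slice T (Pi.single a 1) i j := by
  have : r = ∑ a, ∑ i, ∑ j, r a i j •
      pureArray (k := k) (Pi.single a 1) (Pi.single i 1) (Pi.single j 1) := by
    funext a i j
    fin_cases a <;> fin_cases i <;> fin_cases j <;> simp [pureArray]
  conv_lhs => rw [this]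
  simp [slice]

theorem slice_eq (T : Module.Dual k (Fin 2 → Fin 2 → Fin 2 → k)) (s : Fin 2 → k) (i j : Fin 2) :
    slice T s i j = s 0 * slice T (Pi.single 0 1) i j + s 1 * slice T (Pi.single 1 1) i j := by
  have : pureArray s (Pi.single i 1) (Pi.single j 1)
      = s 0 • pureArray (k := k) (Pi.single 0 1) (Pi.single i 1) (Pi.single j 1)
        + s 1 • pureArray (k := k) (Pi.single 1 1) (Pi.single i 1) (Pi.single j 1) := by
    funext a b c
    fin_cases a <;> simp [pureArray, mul_assoc]
  rw [slice, this, map_add, map_smul, map_smul]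
  rfl

theorem apply_pureArray (T : Module.Dual k (Fin 2 → Fin 2 → Fin 2 → k)) (s y z : Fin 2 → k) :
    T (pureArray s y z) = ∑ i, ∑ j, y i * slice T s i j * z j := by
  have : pureArray s y z
      = ∑ i, ∑ j, (y i * z j) • pureArray (k := k) s (Pi.single i 1) (Pi.single j 1) := by
    funext a b c
    fin_cases b <;> fin_cases c <;> simp [pureArray] <;> ring
  rw [this]
  simp only [map_sum, map_smul, smul_eq_mul, slice]
  exact Finset.sum_congr rfl fun i _ => Finset.sum_congr rfl fun j _ => by ring

/-- The polarisation of the determinants of two slices. -/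
def slicePolar (T : Module.Dual k (Fin 2 → Fin 2 → Fin 2 → k)) (s s' : Fin 2 → k) : k :=
  slice T s 0 0 * slice T s' 1 1 + slice T s' 0 0 * slice T s 1 1
    - slice T s 0 1 * slice T s' 1 0 - slice T s' 0 1 * slice T s 1 0

/-- The discriminant of the determinant on the pencil of slices spanned by `s` and `s'`. -/
def sliceDisc (T : Module.Dual k (Fin 2 → Fin 2 → Fin 2 → k)) (s s' : Fin 2 → k) : k :=
  slicePolar T s s' ^ 2 - 4 * (slice T s).det * (slice T s').det

/-- The discriminant of a binary quadratic form scales by the squared determinant of a base change,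
so its vanishing does not depend on the basis. -/
theorem sliceDisc_eq (T : Module.Dual k (Fin 2 → Fin 2 → Fin 2 → k)) (s s' : Fin 2 → k) :
    sliceDisc T s s' = (s 0 * s' 1 - s 1 * s' 0) ^ 2 *
      sliceDisc T (Pi.single 0 1) (Pi.single 1 1) := by
  simp only [sliceDisc, slicePolar, Matrix.det_fin_two, slice_eq T s, slice_eq T s']
  ring

theorem exists_eq_mul_of_det_eq_zero {A : Matrix (Fin 2) (Fin 2) k} (h : A.det = 0) :
    ∃ y z : Fin 2 → k, ∀ i j, A i j = y i * z j := by
  rw [Matrix.det_fin_two] at h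
  by_cases h₀ : A 0 0 = 0
  · by_cases h₁ : A 0 1 = 0
    · refine ⟨![0, 1], A 1, fun i j => ?_⟩
      fin_cases i <;> fin_cases j <;> simp [h₀, h₁]
    · have h₂ : A 1 0 = 0 := by
        have : A 0 1 * A 1 0 = 0 := by linear_combination A 1 1 * h₀ - h
        exact (mul_eq_zero.1 this).resolve_left h₁
      refine ⟨![1, A 1 1 / A 0 1], A 0, fun i j => ?_⟩
      fin_cases i <;> fin_cases j <;> simp [h₀, h₁, h₂]
  · refine ⟨![1, A 1 0 / A 0 0], A 0, fun i j => ?_⟩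
    fin_cases i <;> fin_cases j <;> simp [h₀]
    field_simp
    linear_combination h

/-- A trilinear form on `k² × k² × k²` with nonzero hyperdeterminant is a sum of two decomposable
forms with independent factors. -/
theorem exists_decomposition_of_disc_ne_zero [IsAlgClosed k] (h2 : (2 : k) ≠ 0)
    (T : Module.Dual k (Fin 2 → Fin 2 → Fin 2 → k))
    (hT : sliceDisc T (Pi.single 0 1) (Pi.single 1 1) ≠ 0) :
    ∃ P Q S : Matrix (Fin 2) (Fin 2) k, P.det ≠ 0 ∧ Q.det ≠ 0 ∧ S.det ≠ 0 ∧
      ∀ r, T r = ∑ a, ∑ i, ∑ j, r a i j * (P 0 a * Q 0 i * S 0 j - P 1 a * Q 1 i * S 1 j) := by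
  let L : Fin 2 → Fin 2 → (Fin 2 → k) →ₗ[k] k := fun i j =>
    slice T (Pi.single 0 1) i j • LinearMap.proj 0 + slice T (Pi.single 1 1) i j • LinearMap.proj 1
  have hL : ∀ i j s, L i j s = slice T s i j := fun i j s => by
    rw [slice_eq T s]
    simp [L]
    ring
  let A := symMul (L 0 0) (L 1 1) - symMul (L 0 1) (L 1 0)
  have hAs : ∀ x y, A x y = A y x := fun x y => by
    simp only [A, LinearMap.sub_apply]
    rw [symMul_comm, symMul_comm (L 0 1)]
  have hAd : ∀ x, A x x = (slice T x).det := fun x => by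
    simp only [A, LinearMap.sub_apply]
    rw [symMul_self h2, symMul_self h2, Matrix.det_fin_two]
    simp only [hL]
  have hAp : ∀ x y, 2 * A x y = slicePolar T x y := fun x y => by
    simp only [A, LinearMap.sub_apply, symMul_apply, hL, slicePolar]
    field_simp
    ring
  rcases exists_eq_sq_or_hyperbolic h2 A hAs with ⟨l, hl⟩ | ⟨p, q, hp, hq, hpq⟩
  -- The square of a linear form on `k²` has discriminant zero.
  · exfalso
    apply hT
    have h₁ := hl (Pi.single 0 1)
    have h₂ := hl (Pi.single 1 1)
    have h₃ := hl (Pi.single 0 1 + Pi.single 1 1)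
    simp only [map_add, LinearMap.add_apply] at h₃
    rw [hAs (Pi.single 1 1)] at h₃
    rw [sliceDisc, ← hAd, ← hAd, ← hAp, h₁, h₂]
    have h₄ : 2 * A (Pi.single 0 1) (Pi.single 1 1)
        = 2 * (l (Pi.single 0 1) * l (Pi.single 1 1)) := by
      linear_combination h₃ - h₁ - h₂
    rw [h₄]
    ring
  · rw [hAd] at hp hq
    have hd : p 0 * q 1 - p 1 * q 0 ≠ 0 := by
      intro h0
      have := sliceDisc_eq T p q
      rw [h0, sliceDisc, hp, hq, ← hAp, hpq] at this
      apply h2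
      have h4 : (2 : k) * 2 = 0 := by linear_combination this
      simpa using h4
    obtain ⟨y, z, hyz⟩ := exists_eq_mul_of_det_eq_zero hp
    obtain ⟨y', z', hyz'⟩ := exists_eq_mul_of_det_eq_zero hq
    have hdet : (y 0 * y' 1 - y 1 * y' 0) * (z 0 * z' 1 - z 1 * z' 0) = 2 := by
      have := hAp p q
      rw [hpq, slicePolar] at this
      simp only [hyz, hyz'] at this
      linear_combination -this
    obtain ⟨d, hd'⟩ : ∃ d, d * (p 0 * q 1 - p 1 * q 0) = 1 := ⟨_, inv_mul_cancel₀ hd⟩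
    -- The slices at the isotropic vectors `p` and `q` have rank one. The rows of the first matrix
    -- are the dual basis vector of `p` and minus that of `q`, the sign matching the difference in
    -- the statement.
    refine ⟨!![d * q 1, - (d * q 0); d * p 1, -(d * p 0)], Matrix.of ![y, y'], Matrix.of ![z, z'], ?_, ?_, ?_, ?_⟩
    · rw [Matrix.det_fin_two]
      simp
      intro h0
      have : d = 0 := by linear_combination (-d) * hd' - h0
      simp [this] at hd'
    · rw [Matrix.det_fin_two]
      simp
      intro h0
      apply h2
      rw [← hdet]
      linear_combination (z 0 * z' 1 - z 1 * z' 0) * h0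
    · rw [Matrix.det_fin_two]
      simp
      intro h0
      apply h2
      rw [← hdet]
      linear_combination (y 0 * y' 1 - y 1 * y' 0) * h0
    · intro r
      rw [apply_eq_sum]
      refine Finset.sum_congr rfl fun a _ => Finset.sum_congr rfl fun i _ =>
        Finset.sum_congr rfl fun j _ => ?_
      congr 1
      have e₁ := slice_eq T p i j
      have e₂ := slice_eq T q i j
      rw [hyz] at e₁
      rw [hyz'] at e₂
      fin_cases a
      · simp
        linear_combination (-slice T (Pi.single 0 1) i j) * hd' - d * q 1 * e₁ + d * p 1 * e₂
      · simp
        linear_combination (-slice T (Pi.single 1 1) i j) * hd' + d * q 0 * e₁ - d * p 0 * e₂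
end

section
variable {k V : Type*} [Field k] [AddCommGroup V] [Module k V]

/-- Otherwise the slices at `s` form a space of matrices of rank at most one. A common kernel vector
`s'` leaves the third factor free, giving infinitely many lines of decomposable arrays in `R`. -/
theorem sliceDet_ne_zero_of_finite_lines [Infinite k]
    (R : Submodule k (Fin 2 → Fin 2 → Fin 2 → k)) (ι : V →ₗ[k] (Fin 2 → Fin 2 → Fin 2 → k) →ₗ[k] k)
    (hι : ∀ r, (∀ x, ι x r = 0) → r ∈ R) (F : Finset (Fin 2 → Fin 2 → Fin 2 → k))
    (hF : ∀ s y z, pureArray s y z ∈ R → ∃ N ∈ F, ∃ c : k, pureArray s y z = c • N)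
    {s : Fin 2 → k} (hs : s ≠ 0) : ∃ x, (slice (ι x) s).det ≠ 0 := by
  by_contra! hcon
  have vne : ∀ t : k, (![1, t] : Fin 2 → k) ≠ 0 := fun t h => one_ne_zero (congrFun h 0)
  let φ : V →ₗ[k] Matrix (Fin 2) (Fin 2) k :=
    { toFun := fun x => slice (ι x) s
      map_add' := fun x y => by ext; simp [slice]
      map_smul' := fun c x => by ext; simp [slice] }
  have hφ : ∀ x i i' j j', φ x i j * φ x i' j' = φ x i j' * φ x i' j := by
    intro T i i' j j'
    have := hcon T
    rw [Matrix.det_fin_two] at this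
    change slice (ι T) s i j * slice (ι T) s i' j' = slice (ι T) s i j' * slice (ι T) s i' j
    fin_cases i <;> fin_cases i' <;> fin_cases j <;> fin_cases j' <;> simp <;>
      first | linear_combination this | linear_combination -this | ring
  obtain ⟨s', hs', hl⟩ | ⟨s', hs', hl⟩ := exists_common_kernel φ hφ
  · have hmem : ∀ t : k, pureArray s s' ![1, t] ∈ R := fun t => by
      refine hι _ fun T => ?_
      rw [apply_pureArray, Finset.sum_comm]
      simp only [← Finset.sum_mul]
      exact Finset.sum_eq_zero fun j _ => mul_eq_zero_of_left (hl T j) _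
    obtain ⟨t, t', hne, c, hc⟩ := exists_ne_smul_eq_of_mem_lines F _
      (fun t => pureArray_ne_zero hs hs' (vne t)) (fun t => hF _ _ _ (hmem t))
    obtain ⟨i, hi⟩ := Function.ne_iff.1 hs
    obtain ⟨j, hj⟩ := Function.ne_iff.1 hs'
    have h₀ := congrFun (congrFun (congrFun hc i) j) 0
    have h₁ := congrFun (congrFun (congrFun hc i) j) 1
    simp only [pureArray, Pi.smul_apply, smul_eq_mul, Matrix.cons_val_zero,
      Matrix.cons_val_one] at h₀ h₁
    refine mul_ne_zero (mul_ne_zero hi hj) (sub_ne_zero.2 hne.symm) ?_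
    linear_combination h₁ - t * h₀
  · have hmem : ∀ t : k, pureArray s ![1, t] s' ∈ R := fun t => by
      refine hι _ fun T => ?_
      rw [apply_pureArray]
      simp only [mul_assoc, ← Finset.mul_sum]
      exact Finset.sum_eq_zero fun j _ => mul_eq_zero_of_right _ (hl T j)
    obtain ⟨t, t', hne, c, hc⟩ := exists_ne_smul_eq_of_mem_lines F _
      (fun t => pureArray_ne_zero hs (vne t) hs') (fun t => hF _ _ _ (hmem t))
    obtain ⟨i, hi⟩ := Function.ne_iff.1 hs
    obtain ⟨j, hj⟩ := Function.ne_iff.1 hs'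
    have h₀ := congrFun (congrFun (congrFun hc i) 0) j
    have h₁ := congrFun (congrFun (congrFun hc i) 1) j
    simp only [pureArray, Pi.smul_apply, smul_eq_mul, Matrix.cons_val_zero,
      Matrix.cons_val_one] at h₀ h₁
    refine mul_ne_zero (mul_ne_zero hi hj) (sub_ne_zero.2 hne.symm) ?_
    linear_combination h₁ - t * h₀

/-- If the forms annihilating `R` are all degenerate, then over every `s` either there is a
decomposable array in `R`, or some slice is degenerate for all of them. -/
theorem exists_pureArray_mem_or_sliceDet_eq_zero [IsAlgClosed k] (h2 : (2 : k) ≠ 0)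
    (h3 : (3 : k) ≠ 0) (R : Submodule k (Fin 2 → Fin 2 → Fin 2 → k))
    (ι : V →ₗ[k] (Fin 2 → Fin 2 → Fin 2 → k) →ₗ[k] k)
    (hι : ∀ r, (∀ x, ι x r = 0) → r ∈ R)
    (hdisc : ∀ x s s', sliceDisc (ι x) s s' = 0)
    (s s' : Fin 2 → k) (hss' : ∀ c : k, s' ≠ c • s) :
    (∃ y z, y ≠ 0 ∧ z ≠ 0 ∧ pureArray s y z ∈ R) ∨
      ∃ s₀ : Fin 2 → k, s₀ ≠ 0 ∧ ∀ x, (slice (ι x) s₀).det = 0 := by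
  let φ : (Fin 2 → k) → V →ₗ[k] Matrix (Fin 2) (Fin 2) k := fun s =>
    { toFun := fun x => slice (ι x) s
      map_add' := fun x y => by ext; simp [slice]
      map_smul' := fun c x => by ext; simp [slice] }
  let L : (Fin 2 → k) → Fin 2 → Fin 2 → V →ₗ[k] k := fun s i j =>
    { toFun := fun x => slice (ι x) s i j
      map_add' := fun x y => by simp [slice]
      map_smul' := fun c x => by simp [slice] }
  have hL : ∀ s i j T, L s i j T = slice (ι T) s i j := fun _ _ _ _ => rfl
  let A : (Fin 2 → k) → V →ₗ[k] V →ₗ[k] k := fun s =>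
    symMul (L s 0 0) (L s 1 1) - symMul (L s 0 1) (L s 1 0)
  have hAs : ∀ s x y, A s x y = A s y x := fun s x y => by
    simp only [A, LinearMap.sub_apply]
    rw [symMul_comm, symMul_comm (L s 0 1)]
  have hAd : ∀ s x, A s x x = (slice (ι x) s).det := fun s x => by
    simp only [A, LinearMap.sub_apply]
    rw [symMul_self h2, symMul_self h2, Matrix.det_fin_two]
    simp only [hL]
  let B : V →ₗ[k] V →ₗ[k] k :=
    symMul (L s 0 0) (L s' 1 1) + symMul (L s' 0 0) (L s 1 1)
      - symMul (L s 0 1) (L s' 1 0) - symMul (L s' 0 1) (L s 1 0)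
  have hBs : ∀ x y, B x y = B y x := fun x y => by
    simp only [B, LinearMap.sub_apply, LinearMap.add_apply]
    rw [symMul_comm, symMul_comm (L s' 0 0), symMul_comm (L s 0 1), symMul_comm (L s' 0 1)]
  have hBd : ∀ x, B x x = slicePolar (ι x) s s' := fun x => by
    simp only [B, LinearMap.sub_apply, LinearMap.add_apply]
    simp only [symMul_self h2, hL, slicePolar]
  have hd : ∀ x, B x x ^ 2 = 4 * A s x x * A s' x x := fun x => by
    have := hdisc x s s'
    rw [sliceDisc, ← hBd, ← hAd, ← hAd] at this
    linear_combination this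
  rcases exists_eq_sq_or_hyperbolic h2 (A s) (hAs s) with ⟨l, hl⟩ | ⟨p, q, hp, hq, hpq⟩
  · left
    -- `T₁` and `ker l` span the whole space. On `ker l` the slices are singular, so a common kernel
    -- vector fixes one factor; the other only has to satisfy the single linear equation given by
    -- `T₁`.
    obtain ⟨T₁, hT₁⟩ : ∃ T₁, ∀ x, l (x - l x • T₁) = 0 := by
      by_cases h : ∃ x, l x ≠ 0
      · obtain ⟨x, hx⟩ := h
        exact ⟨(l x)⁻¹ • x, fun y => by simp [hx]⟩
      · push Not at h
        exact ⟨0, fun x => h _⟩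
    have hφ : ∀ (x : LinearMap.ker l) i i' j j', (φ s ∘ₗ (LinearMap.ker l).subtype) x i j
        * (φ s ∘ₗ (LinearMap.ker l).subtype) x i' j'
        = (φ s ∘ₗ (LinearMap.ker l).subtype) x i j'
          * (φ s ∘ₗ (LinearMap.ker l).subtype) x i' j := by
      intro x i i' j j'
      have := hl x.1
      rw [LinearMap.mem_ker.1 x.2, hAd, Matrix.det_fin_two] at this
      change slice (ι x.1) s i j * slice (ι x.1) s i' j' = slice (ι x.1) s i j' * slice (ι x.1) s i' j
      fin_cases i <;> fin_cases i' <;> fin_cases j <;> fin_cases j' <;> simp <;>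
        first | linear_combination this | linear_combination -this | ring
    have hval : ∀ y z, (∀ x ∈ LinearMap.ker l, ι x (pureArray s y z) = 0) →
        ι T₁ (pureArray s y z) = 0 → pureArray s y z ∈ R := by
      intro y z h₁ h₂
      refine hι _ fun T => ?_
      have := h₁ (T - l T • T₁) (hT₁ _)
      simpa [h₂] using this
    obtain ⟨y, hy, hyl⟩ | ⟨z, hz, hzl⟩ := exists_common_kernel _ hφ
    · let v : Fin 2 → k := fun j => ∑ i, y i * slice (ι T₁) s i j
      obtain ⟨z, hz, hvz⟩ : ∃ z : Fin 2 → k, z ≠ 0 ∧ v 0 * z 0 + v 1 * z 1 = 0 := by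
        by_cases hv : v = 0
        · exact ⟨![1, 0], fun h => one_ne_zero (congrFun h 0), by simp [hv]⟩
        · refine ⟨![v 1, -v 0], fun h => hv ?_, by simp; ring⟩
          have a₀ := congrFun h 0
          have a₁ := congrFun h 1
          funext i
          fin_cases i <;> simp_all
      refine ⟨y, z, hy, hz, hval y z (fun x hx => ?_) ?_⟩
      · rw [apply_pureArray, Finset.sum_comm]
        simp only [← Finset.sum_mul]
        exact Finset.sum_eq_zero fun j _ => mul_eq_zero_of_left (hyl ⟨x, hx⟩ j) _
      · rw [apply_pureArray, Finset.sum_comm]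
        simp only [← Finset.sum_mul]
        rw [Fin.sum_univ_two]
        exact hvz
    · let v : Fin 2 → k := fun i => ∑ j, slice (ι T₁) s i j * z j
      obtain ⟨y, hy, hvy⟩ : ∃ y : Fin 2 → k, y ≠ 0 ∧ y 0 * v 0 + y 1 * v 1 = 0 := by
        by_cases hv : v = 0
        · exact ⟨![1, 0], fun h => one_ne_zero (congrFun h 0), by simp [hv]⟩
        · refine ⟨![v 1, -v 0], fun h => hv ?_, by simp; ring⟩
          have a₀ := congrFun h 0
          have a₁ := congrFun h 1
          funext i
          fin_cases i <;> simp_all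
      refine ⟨y, z, hy, hz, hval y z (fun x hx => ?_) ?_⟩
      · rw [apply_pureArray]
        simp only [mul_assoc, ← Finset.mul_sum]
        exact Finset.sum_eq_zero fun j _ => mul_eq_zero_of_right _ (hzl ⟨x, hx⟩ j)
      · rw [apply_pureArray]
        simp only [mul_assoc, ← Finset.mul_sum]
        rw [Fin.sum_univ_two]
        exact hvy
  · right
    obtain ⟨β, hβ⟩ := exists_proportional_of_hyperbolic h2 h3 (A s) B (hAs s) hBs hp hq hpq
      (fun x hx => by
        have := hd x
        rw [hx] at this
        simpa using this)
    -- From `B² = 4 A_s A_{s'}` and `B = β A_s` follows `4 A_{s'} = β² A_s`. The determinant of this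
    -- slice is `4 A_{s'} - 2 β B + β² A_s = 0`.
    refine ⟨(2 : k) • s' - β • s, fun h => hss' (2⁻¹ * β) ?_, fun T => ?_⟩
    · have : (2 : k) • s' = β • s := by
        rw [sub_eq_zero] at h
        exact h
      rw [mul_smul, ← this, smul_smul, inv_mul_cancel₀ h2, one_smul]
    · have hz := PolynomialOnLines.eq_zero_or_eq_zero (k := k)
        (f := fun x => A s x x) (g := fun x => 4 * A s' x x - β ^ 2 * A s x x)
        (PolynomialOnLines.bilinear _)
        (((PolynomialOnLines.const _).mul (PolynomialOnLines.bilinear _)).sub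
          ((PolynomialOnLines.const _).mul (PolynomialOnLines.bilinear _)))
        (fun x => by
          have := hd x
          rw [hβ] at this
          linear_combination -this)
      have hg := hz.resolve_left (fun h0 => by
        have := h0 (p + q)
        simp only [map_add, LinearMap.add_apply, hp, hq, hpq, hAs s q p] at this
        apply h2
        linear_combination this) T
      have hb := hβ T
      rw [hBd, hAd, slicePolar, Matrix.det_fin_two] at hb
      rw [hAd, hAd, Matrix.det_fin_two, Matrix.det_fin_two] at hg
      rw [Matrix.det_fin_two]
      rw [slice_eq (ι T) s, slice_eq (ι T) s, slice_eq (ι T) s, slice_eq (ι T) s, slice_eq (ι T) s', slice_eq (ι T) s',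
        slice_eq (ι T) s', slice_eq (ι T) s'] at hb hg
      simp only [slice_eq (ι T) ((2 : k) • s' - β • s)]
      simp only [Pi.sub_apply, Pi.smul_apply, smul_eq_mul]
      linear_combination hg - 2 * β * hb

/-- If the decomposable arrays in a space of cubic arrays lie on finitely many lines, then in
suitable coordinates two opposite corners agree on the whole space. -/
theorem exists_equal_corners [IsAlgClosed k] (h2 : (2 : k) ≠ 0) (h3 : (3 : k) ≠ 0)
    (R : Submodule k (Fin 2 → Fin 2 → Fin 2 → k)) (F : Finset (Fin 2 → Fin 2 → Fin 2 → k))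
    (hF : ∀ s y z, pureArray s y z ∈ R → ∃ N ∈ F, ∃ c : k, pureArray s y z = c • N) :
    ∃ P Q S : Matrix (Fin 2) (Fin 2) k, P.det ≠ 0 ∧ Q.det ≠ 0 ∧ S.det ≠ 0 ∧
      ∀ r ∈ R, ∑ a, ∑ i, ∑ j, P 0 a * Q 0 i * S 0 j * r a i j
        = ∑ a, ∑ i, ∑ j, P 1 a * Q 1 i * S 1 j * r a i j := by
  -- Linear forms on the quotient by `R` parametrise the annihilator of `R`.
  let ι : (((Fin 2 → Fin 2 → Fin 2 → k) ⧸ R) →ₗ[k] k) →ₗ[k]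
      (Fin 2 → Fin 2 → Fin 2 → k) →ₗ[k] k := LinearMap.lcomp k k R.mkQ
  have hιa : ∀ x r, ι x r = x (R.mkQ r) := fun _ _ => rfl
  have hι : ∀ r, (∀ x, ι x r = 0) → r ∈ R := fun r h => by
    rw [← Submodule.Quotient.mk_eq_zero, ← Module.forall_dual_apply_eq_zero_iff k]
    exact h
  by_cases hdisc : ∀ x, sliceDisc (ι x) (Pi.single 0 1) (Pi.single 1 1) = 0
  · exfalso
    have hdisc' : ∀ x s s', sliceDisc (ι x) s s' = 0 := fun x s s' => by
      rw [sliceDisc_eq, hdisc x, mul_zero]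
    -- With all hyperdeterminants zero, every first factor `![1, t]` occurs in a decomposable
    -- element of `R`.
    have hmem : ∀ t : k, ∃ y z, y ≠ 0 ∧ z ≠ 0 ∧ pureArray ![1, t] y z ∈ R := fun t => by
      rcases exists_pureArray_mem_or_sliceDet_eq_zero h2 h3 R ι hι hdisc' ![1, t] ![0, 1] (fun c h => by
        have h₀ := congrFun h 0
        have h₁ := congrFun h 1
        simp at h₀ h₁
        simp [← h₀] at h₁) with h | ⟨s₀, hs₀, h⟩
      · exact h
      · obtain ⟨x, hx⟩ := sliceDet_ne_zero_of_finite_lines R ι hι F hF hs₀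
        exact absurd (h x) hx
    choose y z hy hz hR using hmem
    obtain ⟨t, t', hne, c, hc⟩ := exists_ne_smul_eq_of_mem_lines F _
      (fun t => pureArray_ne_zero (fun h => one_ne_zero (congrFun h 0)) (hy t) (hz t))
      (fun t => hF _ _ _ (hR t))
    obtain ⟨i, hi⟩ := Function.ne_iff.1 (hy t')
    obtain ⟨j, hj⟩ := Function.ne_iff.1 (hz t')
    have h₀ := congrFun (congrFun (congrFun hc 0) i) j
    have h₁ := congrFun (congrFun (congrFun hc 1) i) j
    simp only [pureArray, Pi.smul_apply, smul_eq_mul, Matrix.cons_val_zero,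
      Matrix.cons_val_one] at h₀ h₁
    refine mul_ne_zero (mul_ne_zero hi hj) (sub_ne_zero.2 hne.symm) ?_
    linear_combination h₁ - t * h₀
  · push Not at hdisc
    obtain ⟨x, hne⟩ := hdisc
    obtain ⟨P, Q, S, hP, hQ, hS, h⟩ := exists_decomposition_of_disc_ne_zero h2 (ι x) hne
    refine ⟨P, Q, S, hP, hQ, hS, fun r hr => ?_⟩
    have := h r
    rw [hιa, Submodule.mkQ_apply, (Submodule.Quotient.mk_eq_zero R).2 hr, map_zero] at this
    rw [← sub_eq_zero]
    rw [this]
    simp only [← Finset.sum_sub_distrib]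
    exact Finset.sum_congr rfl fun a _ => Finset.sum_congr rfl fun i _ =>
        Finset.sum_congr rfl fun j _ => by ring
end

/-! ### Spaces of `3 × 3` matrices: adjugates and common kernels -/

section
variable {k V : Type*} [Field k] [AddCommGroup V] [Module k V]

/-- The annihilator of a space of square matrices for the trace pairing. -/
def traceAnnihilator (R : Submodule k (Matrix (Fin 3) (Fin 3) k)) :
    Submodule k (Matrix (Fin 3) (Fin 3) k) where
  carrier := {B | ∀ r ∈ R, (B * r).trace = 0}
  add_mem' := fun hB hC r hr => by rw [add_mul, Matrix.trace_add, hB r hr, hC r hr, add_zero]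
  zero_mem' := fun r _ => by rw [zero_mul, Matrix.trace_zero]
  smul_mem' := fun c B hB r hr => by rw [smul_mul_assoc, Matrix.trace_smul, hB r hr, smul_zero]

theorem mem_of_forall_traceAnnihilator {R : Submodule k (Matrix (Fin 3) (Fin 3) k)}
    {r : Matrix (Fin 3) (Fin 3) k} (h : ∀ B ∈ traceAnnihilator R, (B * r).trace = 0) : r ∈ R := by
  rw [← Subspace.forall_mem_dualAnnihilator_apply_eq_zero_iff]
  intro f hf
  have key : ∀ s : Matrix (Fin 3) (Fin 3) k,
      ((Matrix.of fun j i => f (Matrix.single i j 1)) * s).trace = f s := by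
    intro s
    conv_rhs => rw [Matrix.matrix_eq_sum_single s]
    simp only [map_sum, Matrix.trace, Matrix.diag, Matrix.mul_apply, Matrix.of_apply]
    rw [Finset.sum_comm]
    refine Finset.sum_congr rfl fun i _ => Finset.sum_congr rfl fun j _ => ?_
    have : Matrix.single i j (s i j) = s i j • Matrix.single i j (1 : k) := by
      rw [Matrix.smul_single, smul_eq_mul, mul_one]
    rw [this, map_smul, smul_eq_mul, mul_comm]
  rw [← key r]
  apply h
  intro s hs
  rw [key s]
  exact (Submodule.mem_dualAnnihilator f).1 hf s hs

theorem adjugate_fin_three_cyclic {R : Type*} [CommRing R] (A : Matrix (Fin 3) (Fin 3) R) (i j : Fin 3) :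
    A.adjugate i j = A (j + 1) (i + 1) * A (j + 2) (i + 2) - A (j + 1) (i + 2) * A (j + 2) (i + 1) := by
  rw [Matrix.adjugate_fin_three]
  fin_cases i <;> fin_cases j <;> simp <;> ring

theorem minors_eq_zero_of_adjugate_eq_zero {R : Type*} [CommRing R]
    {A : Matrix (Fin 3) (Fin 3) R} (h : A.adjugate = 0)
    (i i' j j' : Fin 3) : A i j * A i' j' = A i j' * A i' j := by
  have h₁ : ∀ i j, A (i + 1) (j + 1) * A (i + 2) (j + 2) = A (i + 1) (j + 2) * A (i + 2) (j + 1) :=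
    fun i j => by
      rw [← sub_eq_zero, ← adjugate_fin_three_cyclic, h, Matrix.zero_apply]
  have h₂ : ∀ i i' : Fin 3, i = i' ∨ (∃ m, i = m + 1 ∧ i' = m + 2) ∨ ∃ m, i = m + 2 ∧ i' = m + 1 := by
    decide
  rcases h₂ i i' with rfl | ⟨m, rfl, rfl⟩ | ⟨m, rfl, rfl⟩ <;>
    rcases h₂ j j' with rfl | ⟨n, rfl, rfl⟩ | ⟨n, rfl, rfl⟩ <;>
    first | ring1 | linear_combination h₁ m n | linear_combination -h₁ m n

/-- The adjugate of the adjugate is `det A • A`. -/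
theorem minors_adjugate_eq_zero {A : Matrix (Fin 3) (Fin 3) k} (h : A.det = 0)
    (i i' j j' : Fin 3) :
    A.adjugate i j * A.adjugate i' j' = A.adjugate i j' * A.adjugate i' j := by
  apply minors_eq_zero_of_adjugate_eq_zero
  rw [Matrix.adjugate_adjugate _ (by simp), h]
  simp

theorem det_smul_add_smul (A B : Matrix (Fin 3) (Fin 3) k) (x y : k) :
    (x • A + y • B).det = x ^ 3 * A.det + x ^ 2 * y * (A.adjugate * B).trace
      + x * y ^ 2 * (B.adjugate * A).trace + y ^ 3 * B.det := by
  simp only [Matrix.det_fin_three, Matrix.adjugate_fin_three, Matrix.trace_fin_three,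
    Matrix.mul_apply, Fin.sum_univ_three, Matrix.add_apply, Matrix.smul_apply, smul_eq_mul,
    Matrix.of_apply, Matrix.cons_val]
  ring

/-- The trace is the derivative of the determinant at `A` along `B`. The odd part of `det (A + t B)`
at `t = ±1` isolates it, since the cubic term vanishes. -/
theorem trace_adjugate_mul_eq_zero (h2 : (2 : k) ≠ 0) {A B : Matrix (Fin 3) (Fin 3) k}
    (hA : A.det = 0) (hB : B.det = 0) (h₁ : (A + B).det = 0) (h₂ : (A - B).det = 0) :
    (A.adjugate * B).trace = 0 := by
  have e₁ := det_smul_add_smul A B 1 1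
  have e₂ := det_smul_add_smul A B 1 (-1)
  rw [one_smul, one_smul, h₁, hA, hB] at e₁
  rw [one_smul, neg_smul, one_smul, ← sub_eq_add_neg, h₂, hA, hB] at e₂
  have : 2 * (A.adjugate * B).trace = 0 := by linear_combination e₂ - e₁
  simpa [h2] using this

theorem polynomialOnLines_entry {ι κ : Type*} (φ : V →ₗ[k] Matrix ι κ k) (i : ι) (j : κ) :
    PolynomialOnLines k (fun x => φ x i j) :=
  PolynomialOnLines.linear ((LinearMap.proj j).comp ((LinearMap.proj i).comp φ : V →ₗ[k] κ → k))

theorem polynomialOnLines_det (φ : V →ₗ[k] Matrix (Fin 3) (Fin 3) k) :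
    PolynomialOnLines k (fun x => (φ x).det) := by
  have e := polynomialOnLines_entry φ
  simp only [Matrix.det_fin_three]
  exact (((((((e 0 0).mul (e 1 1)).mul (e 2 2)).sub (((e 0 0).mul (e 1 2)).mul (e 2 1))).sub
    (((e 0 1).mul (e 1 0)).mul (e 2 2))).add (((e 0 1).mul (e 1 2)).mul (e 2 0))).add
    (((e 0 2).mul (e 1 0)).mul (e 2 1))).sub (((e 0 2).mul (e 1 1)).mul (e 2 0))

/-- A linear space of singular matrices whose adjugates lie on finitely many lines has a common left
or right kernel vector. -/
theorem exists_common_kernel_of_adjugate_lines [Infinite k]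
    (F : Finset (Matrix (Fin 3) (Fin 3) k)) (φ : V →ₗ[k] Matrix (Fin 3) (Fin 3) k)
    (hdet : ∀ x, (φ x).det = 0) (hF : ∀ x, ∃ N ∈ F, ∃ c : k, (φ x).adjugate = c • N) :
    (∃ u : Fin 3 → k, u ≠ 0 ∧ ∀ x j, ∑ i, u i * φ x i j = 0) ∨
      ∃ v : Fin 3 → k, v ≠ 0 ∧ ∀ x i, ∑ j, φ x i j * v j = 0 := by
  classical
  have e := polynomialOnLines_entry φ
  have hadj : ∀ i j, PolynomialOnLines k (fun x => (φ x).adjugate i j) := fun i j => by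
    simp only [adjugate_fin_three_cyclic]
    exact ((e _ _).mul (e _ _)).sub ((e _ _).mul (e _ _))
  obtain ⟨N, hN⟩ := PolynomialOnLines.exists_line
    (F.image fun (N : Matrix (Fin 3) (Fin 3) k) (p : Fin 3 × Fin 3) => N p.1 p.2)
    (fun x (p : Fin 3 × Fin 3) => (φ x).adjugate p.1 p.2) (fun p => hadj p.1 p.2) (fun x => by
      obtain ⟨N, hN, c, hc⟩ := hF x
      exact ⟨_, Finset.mem_image_of_mem _ hN, c, by
        funext p
        rw [hc]
        rfl⟩)
  by_cases hz : ∀ x, (φ x).adjugate = 0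
  · exact exists_common_kernel φ fun x => minors_eq_zero_of_adjugate_eq_zero (hz x)
  push Not at hz
  obtain ⟨x₀, hx₀⟩ := hz
  obtain ⟨i, j, hij⟩ : ∃ i j, (φ x₀).adjugate i j ≠ 0 := by
    by_contra! h
    exact hx₀ (Matrix.ext h)
  left
  have hval : ∀ x, ∃ c : k, ∀ a b, (φ x).adjugate a b = c * N (a, b) := fun x => by
    obtain ⟨c, hc⟩ := hN x
    exact ⟨c, fun a b => congrFun hc (a, b)⟩
  -- Since `adj (φ x) * φ x = 0`, row `i` of `N` kills `φ x` wherever the adjugate is nonzero, hence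
  -- everywhere.
  refine ⟨fun a => N (i, a), fun h => hij ?_, fun x l => ?_⟩
  · obtain ⟨c, hc⟩ := hval x₀
    rw [hc, show N (i, j) = 0 from congrFun h j, mul_zero]
  · simp only [Fin.sum_univ_three]
    refine (PolynomialOnLines.eq_zero_or_eq_zero (hadj i j)
      (g := fun x => N (i, 0) * φ x 0 l + N (i, 1) * φ x 1 l + N (i, 2) * φ x 2 l)
      ((((PolynomialOnLines.const _).mul (e 0 l)).add ((PolynomialOnLines.const _).mul (e 1 l))).add
        ((PolynomialOnLines.const _).mul (e 2 l))) fun x => ?_).resolve_left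
      (fun h => hij (h x₀)) x
    obtain ⟨c, hc⟩ := hval x
    have h₁ := congrFun (congrFun (Matrix.adjugate_mul (φ x)) i) l
    rw [hdet, zero_smul, Matrix.zero_apply, Matrix.mul_apply, Fin.sum_univ_three, hc, hc, hc] at h₁
    rw [hc]
    linear_combination N (i, j) * h₁

/-- Supplies infinitely many pairwise non-proportional vectors orthogonal to `w`, to be tensored
with a common eigenvector. -/
theorem exists_family_orthogonal (w : Fin 3 → k) :
    ∃ v : k → Fin 3 → k, (∀ t, w 0 * v t 0 + w 1 * v t 1 + w 2 * v t 2 = 0) ∧ (∀ t, v t ≠ 0) ∧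
      ∀ t t' (c : k), v t' = c • v t → t = t' := by
  wlog hw : w ≠ 0
  · push Not at hw
    obtain ⟨v, -, h₂, h₃⟩ := this (![1, 0, 0] : Fin 3 → k) (fun h => one_ne_zero (congrFun h 0))
    exact ⟨v, fun t => by simp [hw], h₂, h₃⟩
  obtain ⟨i, hi⟩ := Function.ne_iff.1 hw
  rw [Pi.zero_apply] at hi
  refine ⟨fun t => Pi.single (i + 1) (w i) + Pi.single (i + 2) (t * w i)
    - Pi.single i (w (i + 1) + t * w (i + 2)), fun t => ?_, fun t h => hi ?_, fun t t' c h => ?_⟩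
  · fin_cases i <;> simp <;> ring
  · have := congrFun h (i + 1)
    fin_cases i <;> simpa using this
  · have h₁ := congrFun h (i + 1)
    have h₂ := congrFun h (i + 2)
    have h₃ : w i = c * w i := by fin_cases i <;> simpa using h₁
    have h₄ : t' * w i = c * (t * w i) := by fin_cases i <;> simpa using h₂
    have : (t - t') * w i = 0 := by linear_combination t * h₃ - h₄
    simpa [hi, sub_eq_zero] using this

theorem trace_mul_vecMulVec (B : Matrix (Fin 3) (Fin 3) k) (u v : Fin 3 → k) :
    (B * Matrix.vecMulVec v u).trace = ∑ j, (∑ i, u i * B i j) * v j := by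
  simp only [Matrix.trace_fin_three, Matrix.mul_apply, Matrix.vecMulVec_apply, Fin.sum_univ_three]
  ring

theorem trace_mul_vecMulVec' (B : Matrix (Fin 3) (Fin 3) k) (u v : Fin 3 → k) :
    (B * Matrix.vecMulVec v u).trace = ∑ i, u i * ∑ j, B i j * v j := by
  simp only [Matrix.trace_fin_three, Matrix.mul_apply, Matrix.vecMulVec_apply, Fin.sum_univ_three]
  ring

/-- If the matrices of rank at most one in `R` lie on finitely many lines, then no nonzero vector or
covector is a common eigenvector of the annihilator of `R`. -/
theorem not_exists_kernel_of_finite_lines [Infinite k] {R : Submodule k (Matrix (Fin 3) (Fin 3) k)}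
    {F : Finset (Matrix (Fin 3) (Fin 3) k)}
    (hF : ∀ r ∈ R, (∀ i i' j j', r i j * r i' j' = r i j' * r i' j) → ∃ N ∈ F, ∃ c : k, r = c • N)
    (h : (∃ u : Fin 3 → k, u ≠ 0 ∧ ∀ B ∈ traceAnnihilator R, ∃ c : k,
        ∀ j, ∑ i, u i * B i j = c * u j) ∨
      ∃ v : Fin 3 → k, v ≠ 0 ∧ ∀ B ∈ traceAnnihilator R, ∃ c : k,
        ∀ i, ∑ j, B i j * v j = c * v i) : False := by
  have hvv : ∀ u v : Fin 3 → k, ∀ i i' j j', Matrix.vecMulVec v u i j * Matrix.vecMulVec v u i' j'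
      = Matrix.vecMulVec v u i j' * Matrix.vecMulVec v u i' j := fun u v i i' j j' => by
    simp only [Matrix.vecMulVec_apply]
    ring
  rcases h with ⟨u, hu, h⟩ | ⟨u, hu, h⟩
  · obtain ⟨v, hv, hv0, hvi⟩ := exists_family_orthogonal u
    obtain ⟨i, hi⟩ := Function.ne_iff.1 hu
    -- Orthogonality of `v t` and `u` allows eigenvectors in place of kernel vectors: `u B v = c (u
    -- · v) = 0`.
    have hmem : ∀ t, Matrix.vecMulVec (v t) u ∈ R := fun t =>
      mem_of_forall_traceAnnihilator fun B hB => by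
        obtain ⟨c, hc⟩ := h B hB
        simp only [trace_mul_vecMulVec, hc, Fin.sum_univ_three]
        linear_combination c * hv t
    obtain ⟨t, t', hne, c, hc⟩ := exists_ne_smul_eq_of_mem_lines F
      (fun t => Matrix.vecMulVec (v t) u) (fun t h0 => by
        obtain ⟨j, hj⟩ := Function.ne_iff.1 (hv0 t)
        exact mul_ne_zero hj hi (congrFun (congrFun h0 j) i)) (fun t => hF _ (hmem t) (hvv _ _))
    refine hne (hvi t t' c (funext fun j => mul_right_cancel₀ hi ?_))
    have := congrFun (congrFun hc j) i
    simp only [Matrix.vecMulVec_apply, Matrix.smul_apply, smul_eq_mul] at this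
    rw [this, Pi.smul_apply, smul_eq_mul, mul_assoc]
  · obtain ⟨v, hv, hv0, hvi⟩ := exists_family_orthogonal u
    obtain ⟨i, hi⟩ := Function.ne_iff.1 hu
    have hmem : ∀ t, Matrix.vecMulVec u (v t) ∈ R := fun t =>
      mem_of_forall_traceAnnihilator fun B hB => by
        obtain ⟨c, hc⟩ := h B hB
        simp only [trace_mul_vecMulVec', hc, Fin.sum_univ_three]
        linear_combination c * hv t
    obtain ⟨t, t', hne, c, hc⟩ := exists_ne_smul_eq_of_mem_lines F
      (fun t => Matrix.vecMulVec u (v t)) (fun t h0 => by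
        obtain ⟨j, hj⟩ := Function.ne_iff.1 (hv0 t)
        exact mul_ne_zero hi hj (congrFun (congrFun h0 i) j)) (fun t => hF _ (hmem t) (hvv _ _))
    refine hne (hvi t t' c (funext fun j => mul_left_cancel₀ hi ?_))
    have := congrFun (congrFun hc i) j
    simp only [Matrix.vecMulVec_apply, Matrix.smul_apply, smul_eq_mul] at this
    rw [this, Pi.smul_apply, smul_eq_mul]
    ring

/-- If the determinant vanished on the annihilator, so would its derivative, placing all adjugates
in `R`. They have rank at most one, so finiteness forces a common kernel vector. -/
theorem exists_det_ne_zero_of_finite_lines [Infinite k] (h2 : (2 : k) ≠ 0)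
    {R : Submodule k (Matrix (Fin 3) (Fin 3) k)} {F : Finset (Matrix (Fin 3) (Fin 3) k)}
    (hF : ∀ r ∈ R, (∀ i i' j j', r i j * r i' j' = r i j' * r i' j) → ∃ N ∈ F, ∃ c : k, r = c • N) :
    ∃ B ∈ traceAnnihilator R, B.det ≠ 0 := by
  by_contra! hcon
  have hadj : ∀ B ∈ traceAnnihilator R, B.adjugate ∈ R := fun B hB =>
    mem_of_forall_traceAnnihilator fun C hC => by
      rw [Matrix.trace_mul_comm]
      exact trace_adjugate_mul_eq_zero h2 (hcon B hB) (hcon C hC)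
        (hcon _ (Submodule.add_mem _ hB hC)) (hcon _ (Submodule.sub_mem _ hB hC))
  refine not_exists_kernel_of_finite_lines hF ?_
  refine (exists_common_kernel_of_adjugate_lines F (traceAnnihilator R).subtype
    (fun B => hcon B.1 B.2) (fun B => hF _ (hadj B.1 B.2)
      (minors_adjugate_eq_zero (hcon B.1 B.2)))).imp ?_ ?_
  · rintro ⟨u, hu, h⟩
    exact ⟨u, hu, fun B hB => ⟨0, fun j => by
      rw [zero_mul]
      exact h ⟨B, hB⟩ j⟩⟩
  · rintro ⟨u, hu, h⟩
    exact ⟨u, hu, fun B hB => ⟨0, fun j => by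
      rw [zero_mul]
      exact h ⟨B, hB⟩ j⟩⟩
end

/-! ### Repeated eigenvalues and diagonalisation -/

section
variable {k : Type*} [Field k]

theorem exists_eigenvalues_fin_three [IsAlgClosed k] (B : Matrix (Fin 3) (Fin 3) k) :
    ∃ a b c : k, ∀ t : k, (Matrix.scalar (Fin 3) t - B).det = (t - a) * (t - b) * (t - c) := by
  have hs : B.charpoly.Splits := IsAlgClosed.splits _
  have hcard : Multiset.card B.charpoly.roots = 3 := by
    rw [← hs.natDegree_eq_card_roots, Matrix.charpoly_natDegree_eq_dim, Fintype.card_fin]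
  obtain ⟨a, b, c, habc⟩ := Multiset.card_eq_three.1 hcard
  refine ⟨a, b, c, fun t => ?_⟩
  rw [← Matrix.eval_charpoly, hs.eq_prod_roots_of_monic (Matrix.charpoly_monic B), habc]
  simp [mul_assoc]

theorem det_scalar_sub (B : Matrix (Fin 3) (Fin 3) k) (t : k) :
    (Matrix.scalar (Fin 3) t - B).det
      = t ^ 3 - B.trace * t ^ 2 + B.adjugate.trace * t - B.det := by
  simp only [Matrix.det_fin_three, Matrix.adjugate_fin_three, Matrix.trace_fin_three,
    Matrix.sub_apply, Matrix.scalar_apply, Matrix.diagonal_apply, Matrix.of_apply, Matrix.cons_val]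
  simp
  ring

theorem exists_eigenbasis {B : Matrix (Fin 3) (Fin 3) k} {d : Fin 3 → k}
    (hd : Function.Injective d) (h : ∀ i, (Matrix.scalar (Fin 3) (d i) - B).det = 0) :
    ∃ G : Matrix (Fin 3) (Fin 3) k, G.det ≠ 0 ∧ B * G = G * Matrix.diagonal d := by
  have hv : ∀ i, ∃ v : Fin 3 → k, v ≠ 0 ∧ B.mulVec v = d i • v := fun i => by
    obtain ⟨v, hv, h0⟩ := Matrix.exists_mulVec_eq_zero_iff.2 (h i)
    refine ⟨v, hv, ?_⟩
    rw [Matrix.sub_mulVec, sub_eq_zero] at h0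
    rw [← h0, Matrix.scalar_apply]
    funext j
    simp [Matrix.mulVec_diagonal]
  choose v hv0 hv using hv
  have hli := Module.End.eigenvectors_linearIndependent' (Matrix.toLin' B) d hd v (fun i =>
    ⟨Module.End.mem_eigenspace_iff.2 (by rw [Matrix.toLin'_apply, hv]), hv0 i⟩)
  refine ⟨(Matrix.of v).transpose, ?_, ?_⟩
  · have := Matrix.linearIndependent_rows_iff_isUnit (A := Matrix.of v)
    rw [Matrix.det_transpose]
    exact ((Matrix.isUnit_iff_isUnit_det _).1 (this.1 hli)).ne_zero
  · ext i j
    rw [Matrix.mul_diagonal]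
    have := congrFun (hv j) i
    rw [Pi.smul_apply, smul_eq_mul] at this
    rw [Matrix.transpose_apply, Matrix.of_apply, mul_comm, ← this]
    rfl

/-- A traceless `3 × 3` matrix either has a basis of eigenvectors with distinct eigenvalues or has
eigenvalues `a, a, -2a`. -/
theorem exists_eigenbasis_or_double_root [IsAlgClosed k] (B : Matrix (Fin 3) (Fin 3) k)
    (hB : B.trace = 0) (h2 : (2 : k) ≠ 0) :
    (∃ (d : Fin 3 → k) (G : Matrix (Fin 3) (Fin 3) k), Function.Injective d ∧ G.det ≠ 0 ∧
      B * G = G * Matrix.diagonal d) ∨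
      ∃ a : k, B.adjugate.trace = -3 * a ^ 2 ∧ B.det = -2 * a ^ 3 := by
  obtain ⟨a, b, c, habc⟩ := exists_eigenvalues_fin_three B
  have e : ∀ t : k, t ^ 3 + B.adjugate.trace * t - B.det = (t - a) * (t - b) * (t - c) :=
    fun t => by rw [← habc, det_scalar_sub, hB]; ring
  have e₀ := e 0
  have e₁ := e 1
  have e₂ := e (-1)
  have hdet : B.det = a * b * c := by linear_combination -e₀
  have hsum : a + b + c = 0 := by
    have : 2 * (a + b + c) = 0 := by linear_combination e₁ + e₂ - 2 * e₀
    simpa [h2] using this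
  have hadj : B.adjugate.trace = a * b + b * c + c * a := by
    linear_combination e₁ + hdet - hsum
  by_cases hab : a = b
  · subst hab
    refine Or.inr ⟨a, ?_, ?_⟩
    · rw [hadj]; linear_combination 2 * a * hsum
    · rw [hdet]; linear_combination a ^ 2 * hsum
  by_cases hbc : b = c
  · subst hbc
    refine Or.inr ⟨b, ?_, ?_⟩
    · rw [hadj]; linear_combination 2 * b * hsum
    · rw [hdet]; linear_combination b ^ 2 * hsum
  by_cases hca : c = a
  · subst hca
    refine Or.inr ⟨c, ?_, ?_⟩
    · rw [hadj]; linear_combination 2 * c * hsum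
    · rw [hdet]; linear_combination c ^ 2 * hsum
  left
  have hinj : Function.Injective ![a, b, c] := by
    intro i j hij
    fin_cases i <;> fin_cases j <;> simp_all [eq_comm]
  obtain ⟨G, hG, hBG⟩ := exists_eigenbasis (B := B) hinj (fun i => by
    rw [habc]
    fin_cases i <;> simp)
  exact ⟨_, G, hinj, hG, hBG⟩

/-- If all members of a linear space of traceless matrices have a repeated eigenvalue, then a
repeated eigenvalue depends linearly on the matrix. -/
theorem exists_linear_double_root [IsAlgClosed k] (h2 : (2 : k) ≠ 0) (h3 : (3 : k) ≠ 0)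
    (W : Submodule k (Matrix (Fin 3) (Fin 3) k))
    (h : ∀ B ∈ W, ∃ a : k, B.adjugate.trace = -3 * a ^ 2 ∧ B.det = -2 * a ^ 3) :
    ∃ m : W →ₗ[k] k, ∀ B : W, B.1.adjugate.trace = -3 * m B ^ 2 ∧ B.1.det = -2 * m B ^ 3 := by
  let L : Fin 3 → Fin 3 → W →ₗ[k] k := fun i j =>
    { toFun := fun B => B.1 i j
      map_add' := fun _ _ => rfl
      map_smul' := fun _ _ => rfl }
  have hL : ∀ i j B, L i j B = B.1 i j := fun _ _ _ => rfl
  let A := symMul (L 0 0) (L 1 1) - symMul (L 0 1) (L 1 0) + symMul (L 0 0) (L 2 2)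
    - symMul (L 0 2) (L 2 0) + symMul (L 1 1) (L 2 2) - symMul (L 1 2) (L 2 1)
  have hAs : ∀ x y, A x y = A y x := fun x y => by
    simp only [A, LinearMap.sub_apply, LinearMap.add_apply, symMul_apply]
    ring
  have hAd : ∀ x, A x x = x.1.adjugate.trace := fun x => by
    simp only [A, LinearMap.sub_apply, LinearMap.add_apply, symMul_self h2, hL,
      Matrix.adjugate_fin_three, Matrix.trace_fin_three, Matrix.of_apply, Matrix.cons_val]
    ring
  -- This is the vanishing discriminant of the characteristic polynomial `t³ + A x x * t - det x`.
  have hrel : ∀ x : W, 27 * x.1.det ^ 2 = -4 * A x x ^ 3 := fun x => by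
    obtain ⟨a, h₁, h₂⟩ := h x.1 x.2
    rw [hAd, h₁, h₂]
    ring
  have hdet0 : ∀ x : W, A x x = 0 → x.1.det = 0 := fun x hx => by
    have h27 : (27 : k) ≠ 0 := by
      rw [show (27 : k) = 3 ^ 3 by norm_num]
      exact pow_ne_zero _ h3
    have := hrel x
    rw [hx] at this
    simpa [h27] using this
  rcases exists_eq_sq_or_hyperbolic h2 A hAs with ⟨l, hl⟩ | ⟨p, q, hp, hq, hpq⟩
  · obtain ⟨i, hi⟩ := IsAlgClosed.exists_pow_nat_eq (-3 : k) (n := 2) (by norm_num)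
    have hi0 : i ≠ 0 := by
      rintro rfl
      apply h3
      linear_combination hi
    obtain ⟨m, hm⟩ : ∃ m : W →ₗ[k] k, ∀ x, A x x = -3 * m x ^ 2 := ⟨i⁻¹ • l, fun x => by
      rw [hl, LinearMap.smul_apply, smul_eq_mul, ← hi]
      field_simp⟩
    have hpoly : PolynomialOnLines k (fun x : W => x.1.det) := polynomialOnLines_det W.subtype
    have hm3 := (PolynomialOnLines.const (V := W) (2 : k)).mul ((PolynomialOnLines.linear m).pow 3)
    -- Here `det² = 4 m⁶`, so one factor `det ± 2 m³` vanishes identically; the sign is absorbed in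
    -- `m`.
    rcases (hpoly.add hm3).eq_zero_or_eq_zero (hpoly.sub hm3) (fun x => by
      have h₁ := hrel x
      rw [hm] at h₁
      have h₂ : (3 ^ 3 : k) * (x.1.det ^ 2 - 4 * m x ^ 6) = 0 := by linear_combination h₁
      have h₃ := (mul_eq_zero.1 h₂).resolve_left (pow_ne_zero _ h3)
      linear_combination h₃) with h₀ | h₀
    · exact ⟨m, fun x => ⟨by rw [← hAd, hm], by linear_combination h₀ x⟩⟩
    · refine ⟨-m, fun x => ⟨?_, ?_⟩⟩
      · rw [← hAd, hm, LinearMap.neg_apply]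
        ring
      · rw [LinearMap.neg_apply]
        linear_combination h₀ x
  · exfalso
    obtain ⟨α, hα⟩ : ∃ α, α = (p.1.adjugate * q.1).trace := ⟨_, rfl⟩
    obtain ⟨β, hβ⟩ : ∃ β, β = (q.1.adjugate * p.1).trace := ⟨_, rfl⟩
    -- On the span of `p` and `q` the relation becomes `27 (α x + β y)² = -32 x y` after cancelling
    -- `(x y)²`. This fails because `x y` is not a square; three values suffice to see it.
    have key : ∀ x y : k, 27 * (x ^ 2 * y * α + x * y ^ 2 * β) ^ 2 = -32 * (x * y) ^ 3 := by
      intro x y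
      have h₁ := hrel (x • p + y • q)
      have h₂ := det_smul_add_smul p.1 q.1 x y
      rw [hdet0 p hp, hdet0 q hq, ← hα, ← hβ] at h₂
      rw [show (x • p + y • q : W).1 = x • p.1 + y • q.1 from rfl, h₂] at h₁
      simp only [map_add, map_smul, LinearMap.add_apply, LinearMap.smul_apply, smul_eq_mul,
        hp, hq, hpq, hAs q p] at h₁
      linear_combination h₁
    have k₁ := key 1 1
    have k₂ := key 1 (-1)
    have k₃ := key 1 2
    have e₁ : (2 * 27 : k) * (α ^ 2 + β ^ 2) = 0 := by linear_combination k₁ + k₂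
    have e₂ : (2 * 2 : k) * (27 * (α * β) + 16) = 0 := by linear_combination k₁ - k₂
    have e₃ : 27 * α * β + 16 = 0 := by simpa [h2, mul_assoc] using e₂
    have h27 : (27 : k) = 3 ^ 3 := by norm_num
    have e₄ : α ^ 2 + β ^ 2 = 0 := by
      rw [h27] at e₁
      simpa [h2, h3] using e₁
    have e₅ : (2 ^ 2 * 3 ^ 4 : k) * β ^ 2 = 0 := by
      linear_combination k₃ - 108 * e₄ - 16 * e₃
    have e₆ : β = 0 := by simpa [h2, h3] using e₅
    rw [e₆] at e₃
    have e₇ : (2 : k) ^ 4 = 0 := by linear_combination e₃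
    exact h2 (by simpa using e₇)
end

section
variable {k : Type*} [Field k]

/-- As `R` is traceless, the identity lies in its annihilator. If no member had distinct
eigenvalues, subtracting the repeated one would give a linear space of singular matrices to which
the adjugate argument applies again. -/
theorem exists_eigenbasis_of_finite_lines [IsAlgClosed k] (h2 : (2 : k) ≠ 0) (h3 : (3 : k) ≠ 0)
    {R : Submodule k (Matrix (Fin 3) (Fin 3) k)} {F : Finset (Matrix (Fin 3) (Fin 3) k)}
    (hF : ∀ r ∈ R, (∀ i i' j j', r i j * r i' j' = r i j' * r i' j) → ∃ N ∈ F, ∃ c : k, r = c • N)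
    (htr : ∀ r ∈ R, r.trace = 0) :
    ∃ B ∈ traceAnnihilator R, ∃ (d : Fin 3 → k) (G : Matrix (Fin 3) (Fin 3) k),
      Function.Injective d ∧ G.det ≠ 0 ∧ B * G = G * Matrix.diagonal d := by
  by_contra! hcon
  let W : Submodule k (Matrix (Fin 3) (Fin 3) k) :=
    traceAnnihilator R ⊓ LinearMap.ker (Matrix.traceLinearMap (Fin 3) k k)
  have hone : (1 : Matrix (Fin 3) (Fin 3) k) ∈ traceAnnihilator R := fun r hr => by
    rw [one_mul, htr r hr]
  obtain ⟨m, hm⟩ := exists_linear_double_root h2 h3 W (fun B hB => by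
    rcases exists_eigenbasis_or_double_root B hB.2 h2 with ⟨d, G, hd, hG, hBG⟩ | h
    · exact absurd hBG (hcon B hB.1 d G hd hG)
    · exact h)
  have htrW : ∀ B : W, B.1.trace = 0 := fun B => B.2.2
  -- Shifting by the repeated eigenvalue makes `0` a double eigenvalue, so both the determinant and
  -- the trace of the adjugate vanish.
  let φ : W →ₗ[k] Matrix (Fin 3) (Fin 3) k := W.subtype - m.smulRight 1
  have hφ : ∀ B : W, φ B = B.1 - m B • (1 : Matrix (Fin 3) (Fin 3) k) := fun _ => rfl
  have hchar : ∀ (B : W) (t : k), (Matrix.scalar (Fin 3) t - φ B).det = t ^ 3 + 3 * m B * t ^ 2 := by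
    intro B t
    have : Matrix.scalar (Fin 3) t - φ B = Matrix.scalar (Fin 3) (t + m B) - B.1 := by
      have hs : Matrix.scalar (Fin 3) (m B) = m B • (1 : Matrix (Fin 3) (Fin 3) k) := by
        rw [Matrix.smul_one_eq_diagonal]
        rfl
      rw [hφ, map_add, hs]
      abel
    rw [this, det_scalar_sub, htrW, (hm B).1, (hm B).2]
    ring
  have hdet : ∀ B, (φ B).det = 0 := fun B => by
    have h₀ := hchar B 0
    rw [det_scalar_sub] at h₀
    linear_combination -h₀
  have hadjtr : ∀ B, (φ B).adjugate.trace = 0 := fun B => by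
    have h₁ := hchar B 1
    have h₂ := hchar B (-1)
    rw [det_scalar_sub, hdet] at h₁ h₂
    have : 2 * (φ B).adjugate.trace = 0 := by linear_combination h₁ - h₂
    simpa [h2] using this
  have hdecomp : ∀ C ∈ traceAnnihilator R, ∃ (C₀ : W) (c : k),
      C = φ C₀ + c • (1 : Matrix (Fin 3) (Fin 3) k) := by
    intro C hC
    have hmem : C - (C.trace / 3) • (1 : Matrix (Fin 3) (Fin 3) k) ∈ W := by
      refine ⟨Submodule.sub_mem _ hC (Submodule.smul_mem _ _ hone), ?_⟩
      rw [SetLike.mem_coe, LinearMap.mem_ker, Matrix.traceLinearMap_apply, Matrix.trace_sub,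
        Matrix.trace_smul, Matrix.trace_one, Fintype.card_fin, smul_eq_mul]
      push_cast
      field_simp
      ring
    refine ⟨⟨_, hmem⟩, m ⟨_, hmem⟩ + C.trace / 3, ?_⟩
    rw [hφ, add_smul, ← add_assoc, sub_add_cancel, sub_add_cancel]
  -- The annihilator is spanned by the image of `φ` and the identity, and the adjugate is orthogonal
  -- to both.
  have hadj : ∀ B, (φ B).adjugate ∈ R := fun B => mem_of_forall_traceAnnihilator fun C hC => by
    obtain ⟨C₀, c, rfl⟩ := hdecomp C hC
    rw [Matrix.trace_mul_comm, mul_add, Matrix.trace_add, Matrix.mul_smul, mul_one,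
      Matrix.trace_smul, hadjtr, smul_zero, add_zero]
    refine trace_adjugate_mul_eq_zero h2 (hdet B) (hdet C₀) ?_ ?_
    · rw [← map_add, hdet]
    · rw [← map_sub, hdet]
  refine not_exists_kernel_of_finite_lines hF ?_
  refine (exists_common_kernel_of_adjugate_lines F φ hdet (fun B => hF _ (hadj B)
      (minors_adjugate_eq_zero (hdet B)))).imp ?_ ?_
  · rintro ⟨u, hu, h⟩
    refine ⟨u, hu, fun C hC => ?_⟩
    obtain ⟨C₀, c, rfl⟩ := hdecomp C hC
    refine ⟨c, fun j => ?_⟩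
    simp only [Matrix.add_apply, mul_add, Finset.sum_add_distrib, h C₀ j, Matrix.smul_apply,
      Matrix.one_apply, smul_eq_mul, zero_add]
    simp [mul_comm]
  · rintro ⟨u, hu, h⟩
    refine ⟨u, hu, fun C hC => ?_⟩
    obtain ⟨C₀, c, rfl⟩ := hdecomp C hC
    refine ⟨c, fun j => ?_⟩
    simp only [Matrix.add_apply, add_mul, Finset.sum_add_distrib, h C₀ j, Matrix.smul_apply,
      Matrix.one_apply, smul_eq_mul, zero_add]
    simp

/-- If the matrices of rank at most one in a space of `3 × 3` matrices lie on finitely many lines,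
then in suitable coordinates the diagonal entries agree on the whole space. -/
theorem exists_equal_diagonal [IsAlgClosed k] (h2 : (2 : k) ≠ 0) (h3 : (3 : k) ≠ 0)
    {R : Submodule k (Matrix (Fin 3) (Fin 3) k)} {F : Finset (Matrix (Fin 3) (Fin 3) k)}
    (hF : ∀ r ∈ R, (∀ i i' j j', r i j * r i' j' = r i j' * r i' j) →
      ∃ N ∈ F, ∃ c : k, r = c • N) :
    ∃ P Q : Matrix (Fin 3) (Fin 3) k, P.det ≠ 0 ∧ Q.det ≠ 0 ∧
      ∀ r ∈ R, (P * r * Q) 0 0 = (P * r * Q) 1 1 ∧ (P * r * Q) 1 1 = (P * r * Q) 2 2 := by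
  classical
  obtain ⟨B₀, hB₀, hdet₀⟩ := exists_det_ne_zero_of_finite_lines h2 hF
  have hu : IsUnit B₀.det := hdet₀.isUnit
  -- Right multiplication by `B₀` preserves rank and makes the space traceless.
  obtain ⟨B, hB, d, G, hd, hG, hBG⟩ := exists_eigenbasis_of_finite_lines h2 h3
    (R := R.map (LinearMap.mulRight k B₀)) (F := F.image (· * B₀)) (by
      rintro _ ⟨r, hr, rfl⟩ h
      obtain ⟨N, hN, c, hc⟩ := hF r hr (by
        have hrr : r = (r * B₀) * B₀⁻¹ := (Matrix.mul_nonsing_inv_cancel_right _ _ hu).symm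
        intro i i' j j'
        rw [hrr]
        simp only [Matrix.mul_apply (M := r * B₀), Finset.sum_mul_sum]
        rw [Finset.sum_comm]
        refine Finset.sum_congr rfl fun a _ => Finset.sum_congr rfl fun b _ => ?_
        have := h i i' b a
        simp only [LinearMap.mulRight_apply] at this
        linear_combination B₀⁻¹ a j' * B₀⁻¹ b j * this)
      exact ⟨N * B₀, Finset.mem_image_of_mem (· * B₀) hN, c, by
        rw [LinearMap.mulRight_apply, hc, smul_mul_assoc]⟩) (by
      rintro _ ⟨r, hr, rfl⟩
      rw [LinearMap.mulRight_apply, Matrix.trace_mul_comm]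
      exact hB₀ r hr)
  have h01 : d 0 - d 1 ≠ 0 := sub_ne_zero.2 (hd.ne (by decide))
  have h12 : d 1 - d 2 ≠ 0 := sub_ne_zero.2 (hd.ne (by decide))
  have h20 : d 2 - d 0 ≠ 0 := sub_ne_zero.2 (hd.ne (by decide))
  have hGu : IsUnit G.det := hG.isUnit
  -- In the eigenbasis, the diagonal is orthogonal to `(1, 1, 1)` and `d`, so it is a multiple of
  -- their cross product. Its inverse entries rescale the rows.
  let D : Fin 3 → k := ![(d 1 - d 2)⁻¹, (d 2 - d 0)⁻¹, (d 0 - d 1)⁻¹]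
  refine ⟨Matrix.diagonal D * G⁻¹, B₀ * G, ?_, ?_, fun r hr => ?_⟩
  · rw [Matrix.det_mul, Matrix.det_diagonal, Fin.prod_univ_three]
    refine mul_ne_zero ?_ (Matrix.isUnit_nonsing_inv_det G hGu).ne_zero
    simp [D, h01, h12, h20]
  · rw [Matrix.det_mul]
    exact mul_ne_zero hdet₀ hG
  · obtain ⟨s, hs⟩ : ∃ s, s = G⁻¹ * (r * B₀) * G := ⟨_, rfl⟩
    have hmem : r * B₀ ∈ R.map (LinearMap.mulRight k B₀) := ⟨r, hr, rfl⟩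
    have t₁ : s.trace = 0 := by
      rw [hs, Matrix.trace_mul_comm, ← mul_assoc, Matrix.mul_nonsing_inv _ hGu, one_mul,
        Matrix.trace_mul_comm]
      exact hB₀ r hr
    have t₂ : (Matrix.diagonal d * s).trace = 0 := by
      have e : Matrix.diagonal d = G⁻¹ * B * G := by
        rw [mul_assoc, hBG, ← mul_assoc, Matrix.nonsing_inv_mul _ hGu, one_mul]
      have : Matrix.diagonal d * s = G⁻¹ * (B * (r * B₀) * G) := by
        rw [e, hs]
        simp only [mul_assoc, Matrix.mul_nonsing_inv_cancel_left _ _ hGu]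
      rw [this, Matrix.trace_mul_comm, mul_assoc, Matrix.mul_nonsing_inv _ hGu, mul_one]
      exact hB _ hmem
    have hP : Matrix.diagonal D * G⁻¹ * r * (B₀ * G) = Matrix.diagonal D * s := by
      rw [hs]
      simp only [mul_assoc]
    rw [Matrix.trace_fin_three] at t₁ t₂
    simp only [Matrix.diagonal_mul] at t₂
    rw [hP]
    simp only [Matrix.diagonal_mul, D, Matrix.cons_val]
    constructor
    · field_simp
      linear_combination d 2 * t₁ - t₂
    · field_simp
      linear_combination d 0 * t₁ - t₂
end

/-! ### Relations imposed by minors and by faces -/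

open GorensteinPoints

section
variable {R A : Type*} [CommRing R] [CommRing A]

/-- All `2 × 2` minors of a matrix vanish. -/
def MinorsVanish {ι κ : Type*} (N : Matrix ι κ A) : Prop :=
  ∀ i i' j j', N i j * N i' j' = N i j' * N i' j

/-- Products of two entries of a cubic array do not change when the indices in one direction are
swapped. -/
def FacesVanish (n : Fin 2 → Fin 2 → Fin 2 → A) : Prop :=
  ∀ i i' j j' h h', n i j h * n i' j' h' = n i' j h * n i j' h' ∧
    n i j h * n i' j' h' = n i j' h * n i' j h' ∧ n i j h * n i' j' h' = n i j h' * n i' j' h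

theorem minorsIdeal_le_ker_iff {a b : ℕ} (M : Matrix (Fin a) (Fin b) R) (f : R →+* A) :
    minorsIdeal 2 M ≤ RingHom.ker f ↔ MinorsVanish (M.map f) := by
  rw [minorsIdeal, Ideal.span_le]
  constructor
  · intro h
    have key : ∀ i i' j j', i < i' → j < j' →
        f (M i j) * f (M i' j') = f (M i j') * f (M i' j) := by
      intro i i' j j' hi hj
      have hmono : ∀ {c : ℕ} {x y : Fin c}, x < y → StrictMono ![x, y] := fun hxy => by
        rw [Fin.strictMono_iff_lt_succ]
        intro p
        fin_cases p
        exact hxy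
      have := h ⟨OrderEmbedding.ofStrictMono _ (hmono hi), OrderEmbedding.ofStrictMono _ (hmono hj),
        rfl⟩
      rw [SetLike.mem_coe, RingHom.mem_ker, Matrix.det_fin_two, map_sub, map_mul, map_mul,
        sub_eq_zero] at this
      exact this
    intro i i' j j'
    simp only [Matrix.map_apply]
    rcases lt_trichotomy i i' with hi | rfl | hi <;> rcases lt_trichotomy j j' with hj | rfl | hj <;>
      first
        | ring1
        | linear_combination key _ _ _ _ hi hj
        | linear_combination -key _ _ _ _ hi hj
  · rintro h _ ⟨r, c, rfl⟩
    rw [SetLike.mem_coe, RingHom.mem_ker, Matrix.det_fin_two, map_sub, map_mul, map_mul,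
        sub_eq_zero]
    exact h _ _ _ _

theorem MinorsVanish.mul_mul {ι κ ι' κ' : Type*} [Fintype ι] [Fintype κ]
    {N : Matrix ι κ A} (h : MinorsVanish N)
    (P : Matrix ι' ι A) (Q : Matrix κ κ' A) : MinorsVanish (P * N * Q) := by
  have h₁ : MinorsVanish (P * N) := by
    intro i i' j j'
    simp only [Matrix.mul_apply, Finset.sum_mul_sum]
    refine Finset.sum_congr rfl fun a _ => Finset.sum_congr rfl fun b _ => ?_
    linear_combination P i a * P i' b * h a b j j'
  intro i i' j j'
  simp only [Matrix.mul_apply (M := P * N), Finset.sum_mul_sum]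
  rw [Finset.sum_comm]
  refine Finset.sum_congr rfl fun a _ => Finset.sum_congr rfl fun b _ => ?_
  linear_combination Q a j' * Q b j * h₁ i i' b a

/-- The last three equations equate the products over all four pairs of opposite corners, so they
contain the relations of all six diagonal faces. -/
theorem facesVanish_of_faces {n : Fin 2 → Fin 2 → Fin 2 → A}
    (h₁ : ∀ a, n a 0 0 * n a 1 1 = n a 0 1 * n a 1 0)
    (h₂ : ∀ a, n 0 a 0 * n 1 a 1 = n 0 a 1 * n 1 a 0)
    (h₃ : ∀ a, n 0 0 a * n 1 1 a = n 0 1 a * n 1 0 a)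
    (h₄ : n 0 0 0 * n 1 1 1 = n 0 1 1 * n 1 0 0)
    (h₅ : n 0 0 0 * n 1 1 1 = n 1 0 1 * n 0 1 0)
    (h₆ : n 0 0 0 * n 1 1 1 = n 1 1 0 * n 0 0 1) : FacesVanish n := by
  have two : ∀ i i' : Fin 2, i = i' ∨ (i = 0 ∧ i' = 1) ∨ (i = 1 ∧ i' = 0) := by decide
  have a₀ := h₁ 0
  have a₁ := h₁ 1
  have b₀ := h₂ 0
  have b₁ := h₂ 1
  have c₀ := h₃ 0
  have c₁ := h₃ 1
  have s₁ : ∀ j j' h h', n 0 j h * n 1 j' h' = n 1 j h * n 0 j' h' := by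
    simp only [Fin.forall_fin_two]
    grind
  have s₂ : ∀ i i' h h', n i 0 h * n i' 1 h' = n i 1 h * n i' 0 h' := by
    simp only [Fin.forall_fin_two]
    grind
  have s₃ : ∀ i i' j j', n i j 0 * n i' j' 1 = n i j 1 * n i' j' 0 := by
    simp only [Fin.forall_fin_two]
    grind
  intro i i' j j' h h'
  refine ⟨?_, ?_, ?_⟩
  · rcases two i i' with rfl | ⟨rfl, rfl⟩ | ⟨rfl, rfl⟩
    · rfl
    · exact s₁ _ _ _ _
    · exact (s₁ _ _ _ _).symm
  · rcases two j j' with rfl | ⟨rfl, rfl⟩ | ⟨rfl, rfl⟩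
    · rfl
    · exact s₂ _ _ _ _
    · exact (s₂ _ _ _ _).symm
  · rcases two h h' with rfl | ⟨rfl, rfl⟩ | ⟨rfl, rfl⟩
    · rfl
    · exact s₃ _ _ _ _
    · exact (s₃ _ _ _ _).symm

theorem facesIdeal_le_ker_iff (m : Fin 2 → Fin 2 → Fin 2 → R) (f : R →+* A) :
    facesIdeal m ≤ RingHom.ker f ↔ FacesVanish (fun i j h => f (m i j h)) := by
  rw [facesIdeal, Ideal.span_le]
  have hdet : ∀ a b c d : R, (!![a, b; c, d].det ∈ (RingHom.ker f : Set R)) ↔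
      f a * f d = f b * f c := fun a b c d => by
    rw [SetLike.mem_coe, RingHom.mem_ker, Matrix.det_fin_two_of, map_sub, map_mul, map_mul,
      sub_eq_zero]
  constructor
  · intro h
    refine facesVanish_of_faces (fun a => ?_) (fun a => ?_) (fun a => ?_) ?_ ?_ ?_
    · exact (hdet _ _ _ _).1 (h ⟨a, Or.inl rfl⟩)
    · exact (hdet _ _ _ _).1 (h ⟨a, Or.inr (Or.inl rfl)⟩)
    · exact ((hdet _ _ _ _).1 (h ⟨a, Or.inr (Or.inr (Or.inl rfl))⟩))
    · exact (hdet _ _ _ _).1 (h ⟨0, Or.inr (Or.inr (Or.inr (Or.inl rfl)))⟩)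
    · exact (hdet _ _ _ _).1 (h ⟨0, Or.inr (Or.inr (Or.inr (Or.inr (Or.inl rfl))))⟩)
    · exact (hdet _ _ _ _).1 (h ⟨0, Or.inr (Or.inr (Or.inr (Or.inr (Or.inr rfl))))⟩)
  · rintro h _ ⟨a, rfl | rfl | rfl | rfl | rfl | rfl⟩ <;> rw [hdet]
    · linear_combination (h a a 0 1 0 1).2.2
    · linear_combination (h 0 1 a a 0 1).2.2
    · linear_combination (h 0 1 0 1 a a).2.1
    · linear_combination (h 0 1 0 1 a a.rev).1 
    · linear_combination (h a a.rev 0 1 0 1).2.1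
    · linear_combination (h a a.rev 0 1 0 1).2.2

theorem FacesVanish.transform {n : Fin 2 → Fin 2 → Fin 2 → A} (hn : FacesVanish n)
    (P Q S : Matrix (Fin 2) (Fin 2) A) :
    FacesVanish (fun i j h => ∑ a, ∑ b, ∑ c, P i a * Q j b * S h c * n a b c) := by
  have h₁ : ∀ {n : Fin 2 → Fin 2 → Fin 2 → A}, FacesVanish n →
      FacesVanish (fun i j h => ∑ c, S h c * n i j c) := by
    intro n hn i i' j j' h h'
    simp only [Fin.sum_univ_two]
    refine ⟨?_, ?_, ?_⟩
    · linear_combination S h 0 * S h' 0 * (hn i i' j j' 0 0).1 + S h 0 * S h' 1 * (hn i i' j j' 0 1).1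
        + S h 1 * S h' 0 * (hn i i' j j' 1 0).1 + S h 1 * S h' 1 * (hn i i' j j' 1 1).1
    · linear_combination S h 0 * S h' 0 * (hn i i' j j' 0 0).2.1
        + S h 0 * S h' 1 * (hn i i' j j' 0 1).2.1
        + S h 1 * S h' 0 * (hn i i' j j' 1 0).2.1 + S h 1 * S h' 1 * (hn i i' j j' 1 1).2.1
    · linear_combination S h 0 * S h' 1 * (hn i i' j j' 0 1).2.2
        + S h 1 * S h' 0 * (hn i i' j j' 1 0).2.2
  have h₂ : ∀ {n : Fin 2 → Fin 2 → Fin 2 → A}, FacesVanish n →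
      FacesVanish (fun i j h => ∑ c, Q j c * n i c h) := by
    intro n hn i i' j j' h h'
    simp only [Fin.sum_univ_two]
    refine ⟨?_, ?_, ?_⟩
    · linear_combination Q j 0 * Q j' 0 * (hn i i' 0 0 h h').1 + Q j 0 * Q j' 1 * (hn i i' 0 1 h h').1
        + Q j 1 * Q j' 0 * (hn i i' 1 0 h h').1 + Q j 1 * Q j' 1 * (hn i i' 1 1 h h').1
    · linear_combination Q j 0 * Q j' 1 * (hn i i' 0 1 h h').2.1
        + Q j 1 * Q j' 0 * (hn i i' 1 0 h h').2.1
    · linear_combination Q j 0 * Q j' 0 * (hn i i' 0 0 h h').2.2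
        + Q j 0 * Q j' 1 * (hn i i' 0 1 h h').2.2
        + Q j 1 * Q j' 0 * (hn i i' 1 0 h h').2.2 + Q j 1 * Q j' 1 * (hn i i' 1 1 h h').2.2
  have h₃ : ∀ {n : Fin 2 → Fin 2 → Fin 2 → A}, FacesVanish n →
      FacesVanish (fun i j h => ∑ c, P i c * n c j h) := by
    intro n hn i i' j j' h h'
    simp only [Fin.sum_univ_two]
    refine ⟨?_, ?_, ?_⟩
    · linear_combination P i 0 * P i' 1 * (hn 0 1 j j' h h').1
        + P i 1 * P i' 0 * (hn 1 0 j j' h h').1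
    · linear_combination P i 0 * P i' 0 * (hn 0 0 j j' h h').2.1
        + P i 0 * P i' 1 * (hn 0 1 j j' h h').2.1
        + P i 1 * P i' 0 * (hn 1 0 j j' h h').2.1 + P i 1 * P i' 1 * (hn 1 1 j j' h h').2.1
    · linear_combination P i 0 * P i' 0 * (hn 0 0 j j' h h').2.2
        + P i 0 * P i' 1 * (hn 0 1 j j' h h').2.2
        + P i 1 * P i' 0 * (hn 1 0 j j' h h').2.2 + P i 1 * P i' 1 * (hn 1 1 j j' h h').2.2
  convert h₃ (h₂ (h₁ hn)) using 4
  simp only [Finset.mul_sum, mul_assoc]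

/-- A cubic array with equal opposite corners and a `3 × 3` matrix with constant diagonal built from
the same hexagon of entries define the same relations. -/
theorem facesVanish_iff_minorsVanish {n : Fin 2 → Fin 2 → Fin 2 → A} (hn : n 1 1 1 = n 0 0 0) :
    FacesVanish n ↔ MinorsVanish !![n 0 0 0, n 0 1 1, n 0 0 1; n 1 0 0, n 0 0 0, n 1 0 1;
      n 1 1 0, n 0 1 0, n 0 0 0] := by
  constructor
  · intro h
    apply minors_eq_zero_of_adjugate_eq_zero
    rw [Matrix.adjugate_fin_three]
    ext i j
    have a₁ := (h 0 0 0 1 0 1).2.1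
    have a₂ := (h 1 1 0 1 0 1).2.1
    have a₃ := (h 0 1 0 0 0 1).1
    have a₄ := (h 0 1 1 1 0 1).1
    have a₅ := (h 0 1 0 1 0 0).1
    have a₆ := (h 0 1 0 1 1 1).1
    have a₇ := (h 0 1 0 1 0 1).1
    have a₈ := (h 0 1 0 1 0 1).2.1
    have a₉ := (h 0 1 0 1 0 1).2.2
    rw [hn] at a₂ a₄ a₆ a₇ a₈ a₉
    fin_cases i <;> fin_cases j <;> simp <;>
      first
        | linear_combination a₁
        | linear_combination -a₁
        | linear_combination a₂
        | linear_combination -a₂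
        | linear_combination a₃
        | linear_combination -a₃
        | linear_combination a₄
        | linear_combination -a₄
        | linear_combination a₅
        | linear_combination -a₅
        | linear_combination a₆
        | linear_combination -a₆
        | linear_combination a₇
        | linear_combination a₈
        | linear_combination a₉
  · intro h
    have b₁ := h 0 1 0 1
    have b₂ := h 0 1 0 2
    have b₃ := h 0 1 1 2
    have b₄ := h 0 2 0 1
    have b₅ := h 0 2 0 2
    have b₆ := h 0 2 1 2
    have b₇ := h 1 2 0 1
    have b₈ := h 1 2 0 2
    have b₉ := h 1 2 1 2
    simp at b₁ b₂ b₃ b₄ b₅ b₆ b₇ b₈ b₉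
    refine facesVanish_of_faces (fun a => ?_) (fun a => ?_) (fun a => ?_) ?_ ?_ ?_
    · fin_cases a
      · exact (by linear_combination b₆ : n 0 0 0 * n 0 1 1 = n 0 0 1 * n 0 1 0)
      · simp only [Fin.mk_one, hn]
        exact b₈
    · fin_cases a
      · exact b₂
      · simp only [Fin.mk_one, hn]
        linear_combination b₄
    · fin_cases a
      · exact (by linear_combination -b₇ : n 0 0 0 * n 1 1 0 = n 0 1 0 * n 1 0 0)
      · simp only [Fin.mk_one, hn]
        linear_combination -b₃
    · rw [hn, b₁]
    · rw [hn, b₉]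
    · rw [hn, b₅, mul_comm]
end

/-! ### Invariance and comparison of the ideals -/

section
variable {R : Type*} [CommRing R]

/-- Reduces equality of ideals to equivalence of equations in every quotient ring. -/
theorem Ideal.eq_of_forall_le_ker_mk_iff {I I' : Ideal R}
    (h : ∀ J : Ideal R, I ≤ RingHom.ker (Ideal.Quotient.mk J) ↔
      I' ≤ RingHom.ker (Ideal.Quotient.mk J)) : I = I' := by
  simp only [Ideal.mk_ker] at h
  exact le_antisymm ((h I').2 le_rfl) ((h I).1 le_rfl)

theorem minorsIdeal_mul_mul {a b : ℕ} (M : Matrix (Fin a) (Fin b) R)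
    {P P' : Matrix (Fin a) (Fin a) R} {Q Q' : Matrix (Fin b) (Fin b) R} (hP : P' * P = 1)
    (hQ : Q * Q' = 1) : minorsIdeal 2 (P * M * Q) = minorsIdeal 2 M := by
  refine Ideal.eq_of_forall_le_ker_mk_iff fun J => ?_
  rw [minorsIdeal_le_ker_iff, minorsIdeal_le_ker_iff]
  constructor
  · intro h
    have e : M = P' * (P * M * Q) * Q' := by
      rw [← Matrix.mul_assoc, ← Matrix.mul_assoc, hP, Matrix.one_mul, Matrix.mul_assoc, hQ,
        Matrix.mul_one]
    rw [e, Matrix.map_mul, Matrix.map_mul]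
    exact h.mul_mul _ _
  · intro h
    rw [Matrix.map_mul, Matrix.map_mul]
    exact h.mul_mul _ _

/-- The action of triples of matrices on cubic arrays. -/
def cubeTransform (P Q S : Matrix (Fin 2) (Fin 2) R) (n : Fin 2 → Fin 2 → Fin 2 → R) :
    Fin 2 → Fin 2 → Fin 2 → R :=
  fun i j h => ∑ a, ∑ b, ∑ c, P i a * Q j b * S h c * n a b c

theorem cubeTransform_cubeTransform (P Q S P' Q' S' : Matrix (Fin 2) (Fin 2) R)
    (n : Fin 2 → Fin 2 → Fin 2 → R) :
    cubeTransform P' Q' S' (cubeTransform P Q S n) = cubeTransform (P' * P) (Q' * Q) (S' * S) n := by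
  funext i j h
  simp only [cubeTransform, Fin.sum_univ_two, Matrix.mul_apply]
  ring

theorem cubeTransform_one (n : Fin 2 → Fin 2 → Fin 2 → R) : cubeTransform 1 1 1 n = n := by
  funext i j h
  simp [cubeTransform, Matrix.one_apply]

theorem FacesVanish.map_cubeTransform {A : Type*} [CommRing A] (f : R →+* A)
    {n : Fin 2 → Fin 2 → Fin 2 → R}
    (hn : FacesVanish (fun i j h => f (n i j h))) (P Q S : Matrix (Fin 2) (Fin 2) R) :
    FacesVanish (fun i j h => f (cubeTransform P Q S n i j h)) := by
  convert hn.transform (P.map f) (Q.map f) (S.map f) using 4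
  simp [cubeTransform]

theorem facesIdeal_cubeTransform (n : Fin 2 → Fin 2 → Fin 2 → R)
    {P Q S P' Q' S' : Matrix (Fin 2) (Fin 2) R} (hP : P' * P = 1) (hQ : Q' * Q = 1)
    (hS : S' * S = 1) : facesIdeal (cubeTransform P Q S n) = facesIdeal n := by
  refine Ideal.eq_of_forall_le_ker_mk_iff fun J => ?_
  rw [facesIdeal_le_ker_iff, facesIdeal_le_ker_iff]
  constructor
  · intro h
    have := h.map_cubeTransform _ P' Q' S'
    rwa [cubeTransform_cubeTransform, hP, hQ, hS, cubeTransform_one] at this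
  · intro h
    exact h.map_cubeTransform _ P Q S

theorem facesIdeal_eq_minorsIdeal {n : Fin 2 → Fin 2 → Fin 2 → R} (hn : n 1 1 1 = n 0 0 0) :
    facesIdeal n = minorsIdeal 2 !![n 0 0 0, n 0 1 1, n 0 0 1; n 1 0 0, n 0 0 0, n 1 0 1;
      n 1 1 0, n 0 1 0, n 0 0 0] := by
  refine Ideal.eq_of_forall_le_ker_mk_iff fun J => ?_
  rw [facesIdeal_le_ker_iff, minorsIdeal_le_ker_iff]
  rw [facesVanish_iff_minorsVanish (by rw [hn])]
  refine iff_of_eq (congrArg MinorsVanish ?_)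
  ext i j
  fin_cases i <;> fin_cases j <;> rfl
end

/-! ### Normal forms for linear forms and the equivalence -/

section
variable {n : ℕ} {k : Type*} [Field k]

theorem map_C_mul_map_C_eq_one {m : ℕ} {P P' : Matrix (Fin m) (Fin m) k} (h : P * P' = 1) :
    P.map (MvPolynomial.C : k →+* MvPolynomial (Fin (n + 1)) k) * P'.map MvPolynomial.C = 1 := by
  rw [← Matrix.map_mul, h, Matrix.map_one _ (map_zero _) (map_one _)]

/-- A `3 × 3` matrix of linear forms whose `2 × 2` minors have the largest possible depth is
equivalent to one with constant diagonal. -/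
theorem exists_matrix_equal_diagonal [IsAlgClosed k] (h2 : (2 : k) ≠ 0) (h3 : (3 : k) ≠ 0)
    {M : Matrix (Fin 3) (Fin 3) (MvPolynomial (Fin (n + 1)) k)}
    (hM : ∀ i j, (M i j).IsHomogeneous 1) (hd : (n : ℕ∞) ≤ idealDepth (minorsIdeal 2 M)) :
    ∃ M' : Matrix (Fin 3) (Fin 3) (MvPolynomial (Fin (n + 1)) k),
      (∀ i j, (M' i j).IsHomogeneous 1) ∧ minorsIdeal 2 M' = minorsIdeal 2 M ∧
      M' 0 0 = M' 1 1 ∧ M' 1 1 = M' 2 2 := by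
  classical
  choose φ hφ using fun i j => exists_linear_of_isHomogeneous_one (hM i j)
  let E : (Fin (n + 1) → k) →ₗ[k] Matrix (Fin 3) (Fin 3) k :=
    { toFun := fun x => Matrix.of fun i j => φ i j x
      map_add' := fun x y => by ext; simp
      map_smul' := fun c x => by ext; simp }
  have hE : ∀ x i j, E x i j = φ i j x := fun _ _ _ => rfl
  obtain ⟨F, hF⟩ := exists_finset_lines hd
  -- If `E x` has rank at most one, the minors vanish on the line through `x`, and there are
  -- finitely many such lines.
  obtain ⟨P, Q, hP, hQ, h⟩ := exists_equal_diagonal h2 h3 (R := LinearMap.range E)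
    (F := F.image E) (by
      rintro _ ⟨x, rfl⟩ hr
      obtain ⟨p, hp, c, hc⟩ := hF x ((minorsIdeal_le_ker_iff M (lineRestriction x).toRingHom).2
        (fun i i' j j' => by
          have := hr i i' j j'
          simp only [hE] at this
          simp only [Matrix.map_apply, AlgHom.toRingHom_eq_coe, RingHom.coe_coe, (hφ _ _ x).2]
          rw [mul_mul_mul_comm, ← map_mul, this, map_mul]
          ring))
      exact ⟨E p, Finset.mem_image_of_mem _ hp, c, by rw [hc, map_smul]⟩)
  have hP' := Matrix.nonsing_inv_mul P hP.isUnit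
  have hQ' := Matrix.mul_nonsing_inv Q hQ.isUnit
  have heval : ∀ x i j, MvPolynomial.eval x ((P.map MvPolynomial.C * M * Q.map MvPolynomial.C :
      Matrix (Fin 3) (Fin 3) (MvPolynomial (Fin (n + 1)) k)) i j)
      = (P * E x * Q) i j := fun x i j => by
    simp [Matrix.mul_apply, hE, (hφ _ _ x).1]
  refine ⟨P.map MvPolynomial.C * M * Q.map MvPolynomial.C, fun i j => ?_,
    minorsIdeal_mul_mul M (map_C_mul_map_C_eq_one hP') (map_C_mul_map_C_eq_one hQ'), ?_, ?_⟩
  · simp only [Matrix.mul_apply, Matrix.map_apply, Finset.sum_mul]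
    refine MvPolynomial.IsHomogeneous.sum _ _ _ fun a _ => MvPolynomial.IsHomogeneous.sum _ _ _
      fun b _ => ?_
    simpa using ((MvPolynomial.isHomogeneous_C _ (P i b)).mul (hM b a)).mul
      (MvPolynomial.isHomogeneous_C _ (Q a j))
  -- Over an infinite field, equality of polynomials may be tested on values, which lie in `P * R *
  -- Q`.
  · exact MvPolynomial.funext fun x => by rw [heval, heval, (h _ ⟨x, rfl⟩).1]
  · exact MvPolynomial.funext fun x => by rw [heval, heval, (h _ ⟨x, rfl⟩).2]

/-- A cubic array of linear forms whose face ideal has the largest possible depth is equivalent to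
one with two equal opposite corners. -/
theorem exists_array_equal_corners [IsAlgClosed k] (h2 : (2 : k) ≠ 0) (h3 : (3 : k) ≠ 0)
    {m : Fin 2 → Fin 2 → Fin 2 → MvPolynomial (Fin (n + 1)) k}
    (hm : ∀ i j h, (m i j h).IsHomogeneous 1) (hd : (n : ℕ∞) ≤ idealDepth (facesIdeal m)) :
    ∃ m' : Fin 2 → Fin 2 → Fin 2 → MvPolynomial (Fin (n + 1)) k,
      (∀ i j h, (m' i j h).IsHomogeneous 1) ∧ facesIdeal m' = facesIdeal m ∧
      m' 1 1 1 = m' 0 0 0 := by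
  classical
  choose φ hφ using fun i j h => exists_linear_of_isHomogeneous_one (hm i j h)
  let E : (Fin (n + 1) → k) →ₗ[k] (Fin 2 → Fin 2 → Fin 2 → k) :=
    { toFun := fun x i j h => φ i j h x
      map_add' := fun x y => by funext i j h; simp
      map_smul' := fun c x => by funext i j h; simp }
  have hE : ∀ x i j h, E x i j h = φ i j h x := fun _ _ _ _ => rfl
  obtain ⟨F, hF⟩ := exists_finset_lines hd
  obtain ⟨P, Q, S, hP, hQ, hS, h⟩ := exists_equal_corners h2 h3 (LinearMap.range E)
    (F.image E) (by
      rintro s y z ⟨x, hx⟩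
      obtain ⟨p, hp, c, hc⟩ := hF x ((facesIdeal_le_ker_iff m (lineRestriction x).toRingHom).2
        (fun i i' j j' l l' => by
          have hval : ∀ i j h, φ i j h x = s i * y j * z h := fun i j h => by
            rw [← hE, hx]
            rfl
          simp only [AlgHom.toRingHom_eq_coe, RingHom.coe_coe, (hφ _ _ _ x).2, hval, map_mul]
          refine ⟨?_, ?_, ?_⟩ <;> ring))
      exact ⟨E p, Finset.mem_image_of_mem _ hp, c, by rw [← hx, hc, map_smul]⟩)
  have heval : ∀ x i j l, MvPolynomial.eval x (cubeTransform (P.map MvPolynomial.C)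
      (Q.map MvPolynomial.C) (S.map MvPolynomial.C) m i j l)
      = ∑ a, ∑ b, ∑ c, P i a * Q j b * S l c * E x a b c := fun x i j l => by
    simp [cubeTransform, hE, (hφ _ _ _ x).1]
  refine ⟨cubeTransform (P.map MvPolynomial.C) (Q.map MvPolynomial.C) (S.map MvPolynomial.C) m,
    fun i j l => ?_, facesIdeal_cubeTransform m
      (map_C_mul_map_C_eq_one (Matrix.nonsing_inv_mul P hP.isUnit))
      (map_C_mul_map_C_eq_one (Matrix.nonsing_inv_mul Q hQ.isUnit))
      (map_C_mul_map_C_eq_one (Matrix.nonsing_inv_mul S hS.isUnit)), ?_⟩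
  · refine MvPolynomial.IsHomogeneous.sum _ _ _ fun a _ => MvPolynomial.IsHomogeneous.sum _ _ _
      fun b _ => MvPolynomial.IsHomogeneous.sum _ _ _ fun c _ => ?_
    simpa using (((MvPolynomial.isHomogeneous_C _ (P i a)).mul
      (MvPolynomial.isHomogeneous_C _ (Q j b))).mul
      (MvPolynomial.isHomogeneous_C _ (S l c))).mul (hm a b c)
  · exact MvPolynomial.funext fun x => by rw [heval, heval, h _ ⟨x, rfl⟩]
end

theorem proposition6p3p2 {k : Type*} [Field k] [IsAlgClosed k]
    (h2 : (2 : k) ≠ 0) (h3 : (3 : k) ≠ 0)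
    (X : GorensteinPoints.ClosedSubscheme 4 k) (hX : X ∈ GorensteinPoints.hilbAG 4 k 6 0) :
    GorensteinPoints.IsAngloAmerican X ↔ GorensteinPoints.IsScandinavian X := by
  constructor
  · rintro ⟨m, hm, hd, hI⟩
    obtain ⟨n, hn, hnI, hn1⟩ := exists_array_equal_corners h2 h3 hm hd.ge
    have hnM := (facesIdeal_eq_minorsIdeal hn1).symm.trans hnI
    refine ⟨_, fun i j => ?_, hnM ▸ hd, hI.trans hnM.symm⟩
    fin_cases i <;> fin_cases j <;> exact hn _ _ _
  · rintro ⟨M, hM, hd, hI⟩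
    obtain ⟨N, hN, hNI, h01, h12⟩ := exists_matrix_equal_diagonal h2 h3 hM hd.ge
    -- Inverts the placement of the hexagon in `facesIdeal_eq_minorsIdeal`, with the common diagonal
    -- entry at both corners 000 and 111.
    let n : Fin 2 → Fin 2 → Fin 2 → CoordRing 4 k :=
      ![![![N 0 0, N 0 2], ![N 2 1, N 0 1]], ![![N 1 0, N 1 2], ![N 2 0, N 0 0]]]
    have hnN : facesIdeal n = minorsIdeal 2 N := by
      rw [facesIdeal_eq_minorsIdeal (n := n) rfl]
      congr 1
      ext1 i j
      fin_cases i <;> fin_cases j <;> first | rfl | exact h01 | exact h01.trans h12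
    have hnM := hnN.trans hNI
    refine ⟨n, fun i j h => ?_, hnM ▸ hd, hI.trans hnM.symm⟩
    fin_cases i <;> fin_cases j <;> fin_cases h <;> exact hN _ _
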